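/- Let $d \ge 1$, let $\mathbb{B}_d \subset \mathbb{C}^d$ be the open Euclidean unit ball, and let $H^2_d$ be the Drury--Arveson space, i.e. the reproducing kernel Hilbert space of functions on $\mathbb{B}_d$ with kernel $K(z,w) = \frac{1}{1 - \langle z,w\rangle}$. For a Borel probability measure $\mu$ on $\overline{\mathbb{B}_d}$, let $$\mathcal{E}(\mu) = \sup_{0 \le r < 1} \int \int \operatorname{Re} K(rz, rw)\, d\mu(w)\, d\mu(z) \in [0,\infty].$$ For compact $F \subset \overline{\mathbb{B}_d}$, let $\operatorname{cap}(F) = \sup\{1/\mathcal{E}(\mu) : \mu \text{ a Borel probability measure supported on } F\}$ (with $\operatorname{cap}(\emptyset) = 0$). For arbitrary $E \subset \overline{\mathbb{B}_d}$, let $\operatorname{cap}(E) = \sup\{\operatorname{cap}(F) : F \subset E \text{ compact}\}$ and define the outer $H^2_d$-capacity $\operatorname{cap}^*(E) = \inf\{\operatorname{cap}(G) : G \supset E,\ G \text{ relatively open in } \overline{\mathbb{B}_d}\}$. For $f \in H^2_d$ and $\zeta \in \partial\mathbb{B}_d$, write $f^*(\zeta) = \lim_{r \nearrow 1} f(r\zeta)$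 whenever this limit exists in $\mathbb{C}$, and let $Z(f^*) = \{\zeta \in \partial\mathbb{B}_d : f^*(\zeta) \text{ exists and } f^*(\zeta) = 0\}$. For $E \subset \partial\mathbb{B}_d$, say that $f^* = 0$ quasi-everywhere on $E$ if $\operatorname{cap}^*(E \setminus Z(f^*)) = 0$. A function $f \in H^2_d$ is cyclic if there is a sequence of polynomials $(p_n)$ such that $p_n f \to 1$ in $H^2_d$. A multiplier of $H^2_d$ is a function $\varphi : \mathbb{B}_d \to \mathbb{C}$ with $\varphi f \in H^2_d$ for all $f \in H^2_d$. Then: 1. For every $f \in H^2_d$, the boundary value $f^*(\zeta)$ exists for all $\zeta \in \partial\mathbb{B}_d$ outside a set of outer $H^2_d$-capacity zero. 2. If $f \in H^2_d$ is cyclic, then $Z(f^*)$ has outer $H^2_d$-capacity zero, i.e. $\operatorname{cap}^*(Z(f^*)) = 0$. 3. For every subset $E \subset \partial\mathbb{B}_d$, the set $\{f \in H^2_d : f^* = 0 \text{ quasi-everywhere on } E\}$ is a closed linear subspace of $H^2_d$ that is invariant under multiplication by every multiplier of $H^2_d$. -/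

import Mathlib

open MeasureTheory Filter Topology
open scoped ENNReal

noncomputable section

/-- The ambient space `ℂ^d` with its Euclidean norm. -/
abbrev CSpace (d : ℕ) : Type := EuclideanSpace ℂ (Fin d)

/-- The open Euclidean unit ball of `ℂ^d`. -/
abbrev UnitBall (d : ℕ) : Type := ↥(Metric.ball (0 : CSpace d) 1)

/-- The Drury--Arveson kernel `K(z, w) = 1 / (1 - ⟨z, w⟩)` with `⟨z, w⟩ = ∑ i, z i * conj (w i)`;
Mathlib's inner product is conjugate linear in its first argument. -/
def daKernel {d : ℕ} (z w : CSpace d) : ℂ := 1 / (1 - inner ℂ w z)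

/-- The kernel on the ball, in the operator-valued format of Mathlib's theory of reproducing
kernels: the entry at `(z, w)` is multiplication by `K(z, w)` on `ℂ`. -/
def daMatrix (d : ℕ) : Matrix (UnitBall d) (UnitBall d) (ℂ →L[ℂ] ℂ) :=
  Matrix.of fun z w => daKernel (z : CSpace d) (w : CSpace d) • ContinuousLinearMap.id ℂ ℂ

section PositiveSemidefinite

open scoped ComplexOrder

lemma norm_inner_ball_lt_one {d : ℕ} (z w : UnitBall d) :
    ‖inner ℂ (w : CSpace d) (z : CSpace d)‖ < 1 := by
  have hz : ‖(z : CSpace d)‖ < 1 := mem_ball_zero_iff.1 z.2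
  have hw : ‖(w : CSpace d)‖ < 1 := mem_ball_zero_iff.1 w.2
  calc ‖inner ℂ (w : CSpace d) (z : CSpace d)‖
      ≤ ‖(w : CSpace d)‖ * ‖(z : CSpace d)‖ := norm_inner_le_norm _ _
    _ < 1 := by nlinarith [norm_nonneg (z : CSpace d), norm_nonneg (w : CSpace d)]

lemma inner_posSemidef (d : ℕ) :
    (Matrix.of fun z w : UnitBall d => inner ℂ (w : CSpace d) (z : CSpace d)).PosSemidef := by
  refine ⟨by ext z w; simp [Matrix.conjTranspose_apply], fun x => ?_⟩
  have : (x.sum fun i xi => x.sum fun j xj => star xi *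
      (Matrix.of fun z w : UnitBall d => inner ℂ (w : CSpace d) (z : CSpace d)) i j * xj)
      = inner ℂ (x.sum fun z a => star a • (z : CSpace d))
          (x.sum fun z a => star a • (z : CSpace d)) := by
    simp only [Finsupp.sum, sum_inner, inner_sum, inner_smul_left, inner_smul_right,
      Finset.mul_sum]
    refine Finset.sum_congr rfl fun i _ => Finset.sum_congr rfl fun j _ => ?_
    simp
    ring
  rw [this, inner_self_eq_norm_sq_to_K]
  simp

lemma inner_pow_posSemidef (d n : ℕ) :
    (Matrix.of fun z w : UnitBall d =>
      (inner ℂ (w : CSpace d) (z : CSpace d)) ^ n).PosSemidef := by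
  induction n with
  | zero =>
    refine ⟨by ext z w; simp [Matrix.conjTranspose_apply], fun x => ?_⟩
    have : (x.sum fun i xi => x.sum fun j xj => star xi *
        (Matrix.of fun z w : UnitBall d =>
          (inner ℂ (w : CSpace d) (z : CSpace d)) ^ 0) i j * xj)
        = star (x.sum fun _ xi => xi) * (x.sum fun _ xi => xi) := by
      simp [Finsupp.sum, Finset.sum_mul_sum]
    rw [this]
    exact star_mul_self_nonneg _
  | succ n ih =>
    have h := ih.hadamard (inner_posSemidef d)
    have e : (Matrix.of fun z w : UnitBall d =>
        (inner ℂ (w : CSpace d) (z : CSpace d)) ^ (n + 1)) =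
        (Matrix.of fun z w : UnitBall d => (inner ℂ (w : CSpace d) (z : CSpace d)) ^ n).hadamard
          (Matrix.of fun z w : UnitBall d => inner ℂ (w : CSpace d) (z : CSpace d)) := by
      ext z w
      simp [Matrix.hadamard_apply, pow_succ]
    rw [e]
    exact h

lemma daMatrix_posSemidef (d : ℕ) : (daMatrix d).PosSemidef := by
  have key := (RKHS.posSemidef_tfae (K := daMatrix d)).out 0 2
  refine key.2 ⟨?_, fun v => ?_⟩
  · have h1 : star (ContinuousLinearMap.id ℂ ℂ) = ContinuousLinearMap.id ℂ ℂ :=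
      star_one (ℂ →L[ℂ] ℂ)
    ext z w
    simp [daMatrix, daKernel, Matrix.conjTranspose_apply, star_smul, h1]
  · have hs : HasSum (fun n : ℕ => v.sum fun z a => v.sum fun w b =>
        star a * (inner ℂ (w : CSpace d) (z : CSpace d)) ^ n * b)
        (v.sum fun z a => v.sum fun w b => inner ℂ (daMatrix d w z a) b) := by
      simp only [Finsupp.sum]
      refine hasSum_sum fun z _ => hasSum_sum fun w _ => ?_
      have h := hasSum_geometric_of_norm_lt_one (norm_inner_ball_lt_one z w)
      have h2 := (h.mul_left (star (v z))).mul_right (v w)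
      have e : inner ℂ (daMatrix d w z (v z)) (v w) =
          star (v z) * (1 - inner ℂ (w : CSpace d) (z : CSpace d))⁻¹ * v w := by
        simp [daMatrix, daKernel]
        ring
      rw [e]
      exact h2
    have hn : ∀ n : ℕ, 0 ≤ v.sum fun z a => v.sum fun w b =>
        star a * (inner ℂ (w : CSpace d) (z : CSpace d)) ^ n * b :=
      fun n => (inner_pow_posSemidef d n).2 v
    have h0 := hs.nonneg hn
    exact (Complex.le_def.1 h0).1

end PositiveSemidefinite

instance daMatrix_fact (d : ℕ) : Fact (daMatrix d).PosSemidef := ⟨daMatrix_posSemidef d⟩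

/-- The Drury--Arveson space `H^2_d`: the reproducing kernel Hilbert space of functions on the
unit ball with kernel `1 / (1 - ⟨z, w⟩)`. -/
abbrev DruryArveson (d : ℕ) : Type := RKHS.OfKernel (daMatrix d)

/-- The energy `E(μ) = sup_{0 ≤ r < 1} ∫ ∫ Re K(r z, r w) dμ(w) dμ(z) ∈ [0, ∞]` of a measure on the
closed ball (the integrand is bounded and continuous there). -/
def energy {d : ℕ} (μ : Measure (CSpace d)) : ℝ≥0∞ :=
  ⨆ r ∈ Set.Ico (0 : ℝ) 1,
    ENNReal.ofReal (∫ z, ∫ w, (daKernel (r • z) (r • w)).re ∂μ ∂μ)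

/-- The capacity of a compact subset `F` of the closed ball: the supremum of `1 / E(μ)` over the
Borel probability measures `μ` supported on `F` (it is `0` if `F` is empty). -/
def compactCapacity {d : ℕ} (F : Set (CSpace d)) : ℝ≥0∞ :=
  ⨆ (μ : Measure (CSpace d)) (_ : IsProbabilityMeasure μ) (_ : μ Fᶜ = 0), (energy μ)⁻¹

/-- The inner capacity of a subset of the closed ball. -/
def innerCapacity {d : ℕ} (E : Set (CSpace d)) : ℝ≥0∞ :=
  ⨆ (F : Set (CSpace d)) (_ : F ⊆ E) (_ : IsCompact F), compactCapacity F

/-- The outer capacity of a subset of the closed ball: the infimum of the inner capacities of the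
relatively open subsets `G ∩ closedBall 0 1` of the closed ball that contain it. -/
def outerCapacity {d : ℕ} (E : Set (CSpace d)) : ℝ≥0∞ :=
  ⨅ (G : Set (CSpace d)) (_ : IsOpen G) (_ : E ⊆ G),
    innerCapacity (G ∩ Metric.closedBall 0 1)

/-- `f^*(ζ)` exists and equals `c`: `f (r ζ) → c` as `r ↗ 1`. For `ζ` in the unit sphere and
`0 ≤ r < 1` the point `r ζ` lies in the ball, so the extension of `f` by `0` outside the ball
plays no role. -/
def HasRadialLimit {d : ℕ} (f : DruryArveson d) (ζ : CSpace d) (c : ℂ) : Prop :=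
  Tendsto (fun r : ℝ => Function.extend (Subtype.val : UnitBall d → CSpace d) (fun z => f z) 0
    (r • ζ)) (𝓝[<] (1 : ℝ)) (𝓝 c)

/-- `Z(f^*)`: the points of the sphere at which the boundary function exists and vanishes. -/
def boundaryZeroSet {d : ℕ} (f : DruryArveson d) : Set (CSpace d) :=
  {ζ | ζ ∈ Metric.sphere 0 1 ∧ HasRadialLimit f ζ 0}

/-- `f^* = 0` quasi-everywhere on `E`. -/
def VanishesQuasiEverywhereOn {d : ℕ} (f : DruryArveson d) (E : Set (CSpace d)) : Prop :=
  outerCapacity (E \ boundaryZeroSet f) = 0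

/-- `f` is cyclic: there are polynomials `p n` such that `p n * f` converges to the constant
function `1` in the norm of the Drury--Arveson space. -/
def IsCyclicFunction {d : ℕ} (f : DruryArveson d) : Prop :=
  ∃ (p : ℕ → MvPolynomial (Fin d) ℂ) (g : ℕ → DruryArveson d) (u : DruryArveson d),
    (∀ n (z : UnitBall d), g n z = MvPolynomial.eval (fun i => (z : CSpace d) i) (p n) * f z) ∧
    (∀ z : UnitBall d, u z = 1) ∧
    Tendsto g atTop (𝓝 u)

/-- `φ` is a multiplier of the Drury--Arveson space: `φ f ∈ H^2_d` for all `f ∈ H^2_d`. -/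
def IsMultiplier {d : ℕ} (φ : UnitBall d → ℂ) : Prop :=
  ∀ f : DruryArveson d, ∃ g : DruryArveson d, ∀ z : UnitBall d, g z = φ z * f z

end

/-!
The heart of the matter is a capacitary weak type inequality for the radial maximal function,
`cap {sup_r |f (r z)| > t} ≤ 80 ‖f‖² / t²` (`innerCapacity_radialSuperlevelSet_le`).

Let `F` be a compact subset of that set, and `μ` a probability measure on `F`. By compactness it is
enough to consider radii `r ≤ R²` for a fixed `R < 1`, and the energy of `μ` is at least
`‖∫ K_{Rz} dμ(z)‖²`, which is approximated by the energies of finitely supported measures on `F`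
with respect to the positive continuous kernel `Re K(Rz, Rw)`. On a finite set of nodes there are
energy minimizing weights `p`, whose potential equals the minimal energy `A` on their support
(`exists_minimizer_stdSimplex`). By the Schur test, `p` is a Carleson measure with constant `2A`
(`sum_norm_sq_le_of_row_sums`); tested on the kernel functions, this bounds the Poisson-type
integrals `∑ p_j (1 - |y|²) |K(R x_j, y)|²` by `2A`, for all `y` in the ball. For any choice of radii
`r_i`, the number `Re K(r_i x_i, r_j x_j)` is dominated by `Re K(R x_i, R x_j)` and such Poisson-type
kernels (`re_one_div_one_sub_mul_le`), so `∑ p_i p_j Re K(r_i x_i, r_j x_j) ≤ 20 A`, and duality gives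
`∑ p_i |f (r_i x_i)| ≤ C ‖f‖ √A` (`sq_le_of_le_norm_apply`). If `|f (r_i x_i)| > t` at all nodes, `A`
is therefore bounded below by a multiple of `t² / ‖f‖²`.

Countable unions of sets of outer capacity zero have outer capacity zero
(`outerCapacity_iUnion_eq_zero`), because `Re K ≥ 0` makes the energy decrease under restriction of
the measure. The three assertions follow by approximation: by combinations of kernel functions,
which are continuous up to the sphere, for the existence of radial limits; by `1 - p_n f`, which has
boundary value `1` on `Z(f^*)`, for cyclic functions; by a convergent sequence for closedness.
Multipliers are bounded, by the closed graph theorem, and so preserve vanishing boundary values.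
-/

noncomputable section

/-- The reproducing kernel function `K(·, w)` as an element of `H^2_d`. -/
def kernelFunction {d : ℕ} (w : UnitBall d) : DruryArveson d :=
  RKHS.kerFun (DruryArveson d) w 1

variable {d : ℕ}

lemma inner_kernelFunction (w : UnitBall d) (f : DruryArveson d) :
    inner ℂ (kernelFunction w) f = f w := by
  rw [kernelFunction, RKHS.kerFun_inner]
  simp

lemma kernelFunction_apply (z w : UnitBall d) :
    kernelFunction w z = daKernel (z : CSpace d) (w : CSpace d) := by
  rw [kernelFunction, RKHS.kerFun_apply, RKHS.OfKernel.kernel_ofKernel]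
  simp [daMatrix]

lemma norm_sq_kernelFunction (w : UnitBall d) :
    ‖kernelFunction w‖ ^ 2 = 1 / (1 - ‖(w : CSpace d)‖ ^ 2) := by
  have h := inner_self_eq_norm_sq_to_K (𝕜 := ℂ) (kernelFunction w)
  rw [inner_kernelFunction, kernelFunction_apply, daKernel, inner_self_eq_norm_sq_to_K] at h
  simp only [Complex.coe_algebraMap] at h
  exact_mod_cast h.symm

/-! ### Finite combinations of kernel functions -/

/-- Duality between `H^2_d` and finite real combinations of point evaluations, whose squared norm is
the quadratic form of `Re K`. -/
lemma sq_sum_mul_re_le {ι : Type*} [Fintype ι] (y : ι → UnitBall d) (q : ι → ℝ)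
    (f : DruryArveson d) :
    (∑ i, q i * (f (y i)).re) ^ 2 ≤
      ‖f‖ ^ 2 * ∑ i, ∑ j, q i * q j * (daKernel (y i : CSpace d) (y j : CSpace d)).re := by
  set v : DruryArveson d := ∑ i, (q i : ℂ) • kernelFunction (y i) with hv
  have h1 : ∀ g : DruryArveson d, (inner ℂ v g).re = ∑ i, q i * (g (y i)).re := by
    intro g
    simp only [hv, sum_inner, inner_smul_left, inner_kernelFunction, Complex.re_sum,
      Complex.conj_ofReal, Complex.re_ofReal_mul]
  have h2 : ‖v‖ ^ 2 = ∑ i, ∑ j, q i * q j * (daKernel (y i : CSpace d) (y j : CSpace d)).re := by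
    have h3 : ∀ i, (v (y i)).re = ∑ j, q j * (daKernel (y i : CSpace d) (y j : CSpace d)).re := by
      intro i
      rw [← inner_kernelFunction, hv, inner_sum]
      simp only [inner_smul_right, inner_kernelFunction, kernelFunction_apply, Complex.re_sum,
        Complex.re_ofReal_mul]
    have h4 := h1 v
    rw [inner_self_eq_norm_sq_to_K] at h4
    have h5 : (((‖v‖ : ℂ)) ^ 2).re = ‖v‖ ^ 2 := by norm_cast
    simp only [Complex.coe_algebraMap] at h4
    rw [← h5, h4]
    refine Finset.sum_congr rfl fun i _ => ?_
    rw [h3, Finset.mul_sum]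
    exact Finset.sum_congr rfl fun j _ => by ring
  rw [← h1, ← h2, ← mul_pow, mul_comm]
  refine sq_le_sq' ?_ ?_
  · have := (abs_le.1 ((Complex.abs_re_le_norm _).trans (norm_inner_le_norm (𝕜 := ℂ) v f))).1
    linarith
  · exact (abs_le.1 ((Complex.abs_re_le_norm _).trans (norm_inner_le_norm (𝕜 := ℂ) v f))).2

/-! ### Equilibrium weights and the Schur test -/

open Matrix in
/-- Frostman's theorem on a finite set: the potential `M *ᵥ p` of an energy minimizing probability
vector `p` is equal to the minimal energy wherever `p` has mass. -/
lemma exists_minimizer_stdSimplex {ι : Type*} [Fintype ι] [Nonempty ι]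
    (M : Matrix ι ι ℝ) (hM : M.IsSymm) :
    ∃ p ∈ stdSimplex ℝ ι, (∀ q ∈ stdSimplex ℝ ι, p ⬝ᵥ M *ᵥ p ≤ q ⬝ᵥ M *ᵥ q) ∧
      ∀ i, p i * (M *ᵥ p) i = p i * (p ⬝ᵥ M *ᵥ p) := by
  classical
  have hcont : Continuous fun p : ι → ℝ => p ⬝ᵥ M *ᵥ p := by fun_prop
  obtain ⟨p, hp, hmin⟩ := (isCompact_stdSimplex ℝ ι).exists_isMinOn
    ⟨Pi.single (Classical.arbitrary ι) 1, single_mem_stdSimplex ℝ _⟩ hcont.continuousOn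
  refine ⟨p, hp, fun q hq => hmin hq, ?_⟩
  set A := p ⬝ᵥ M *ᵥ p with hA
  -- the first variation of the energy in the direction of the unit mass at `i`
  have key : ∀ i, A ≤ (M *ᵥ p) i := by
    intro i
    have hexp : ∀ ε : ℝ, ((1 - ε) • p + ε • Pi.single i 1) ⬝ᵥ M *ᵥ
        ((1 - ε) • p + ε • Pi.single i (1 : ℝ)) =
        (1 - ε) ^ 2 * A + 2 * ε * (1 - ε) * (M *ᵥ p) i + ε ^ 2 * M i i := by
      intro ε
      have hs : p ⬝ᵥ M.col i = (M *ᵥ p) i := by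
        rw [dotProduct_comm]
        simp [Matrix.mulVec, dotProduct, Matrix.col, hM.apply]
      simp only [mulVec_add, mulVec_smul, add_dotProduct, dotProduct_add, smul_dotProduct,
        dotProduct_smul, single_dotProduct, mulVec_single_one, smul_eq_mul, one_mul, hs, ← hA]
      simp [Matrix.col]
      ring
    have h0 : ∀ ε ∈ Set.Ioc (0 : ℝ) 1, 0 ≤ 2 * ((M *ᵥ p) i - A) +
        ε * (A - 2 * (M *ᵥ p) i + M i i) := by
      intro ε hε
      have hmem : (1 - ε) • p + ε • Pi.single i (1 : ℝ) ∈ stdSimplex ℝ ι :=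
        convex_stdSimplex ℝ ι hp (single_mem_stdSimplex ℝ i) (by linarith [hε.2]) hε.1.le
          (by ring)
      have h1 : A ≤ ((1 - ε) • p + ε • Pi.single i 1) ⬝ᵥ M *ᵥ
          ((1 - ε) • p + ε • Pi.single i (1 : ℝ)) := hmin hmem
      rw [hexp] at h1
      have h2 : 0 ≤ ε * (2 * ((M *ᵥ p) i - A) + ε * (A - 2 * (M *ᵥ p) i + M i i)) := by
        linarith
      exact nonneg_of_mul_nonneg_right h2 hε.1
    have hlim : Tendsto (fun ε : ℝ => 2 * ((M *ᵥ p) i - A) +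
        ε * (A - 2 * (M *ᵥ p) i + M i i)) (𝓝[>] 0) (𝓝 (2 * ((M *ᵥ p) i - A))) := by
      have : Continuous fun ε : ℝ => 2 * ((M *ᵥ p) i - A) +
        ε * (A - 2 * (M *ᵥ p) i + M i i) := by fun_prop
      simpa using (this.tendsto 0).mono_left nhdsWithin_le_nhds
    have := ge_of_tendsto hlim (by
      filter_upwards [Ioc_mem_nhdsGT (zero_lt_one' ℝ)] with ε hε using h0 ε hε)
    linarith
  have hsum : ∑ i, p i * ((M *ᵥ p) i - A) = 0 := by
    simp only [mul_sub, Finset.sum_sub_distrib, ← Finset.sum_mul, hp.2]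
    rw [hA]
    simp [dotProduct]
  intro i
  have := (Finset.sum_eq_zero_iff_of_nonneg
    (fun i _ => mul_nonneg (hp.1 i) (sub_nonneg.2 (key i)))).1 hsum i (Finset.mem_univ i)
  linarith

/-- The Schur test: for a nonnegative symmetric kernel whose potential is `A` on the support of `p`,
the quadratic form of `M` on `L²(p)` is bounded by `A`. -/
lemma sum_mul_mul_le_of_row_sums {ι : Type*} [Fintype ι] {M : ι → ι → ℝ} {p : ι → ℝ} {A : ℝ}
    (hM : ∀ i j, 0 ≤ M i j) (hs : ∀ i j, M i j = M j i) (hp : ∀ i, 0 ≤ p i)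
    (hA : ∀ i, p i * ∑ j, M i j * p j = p i * A) (g : ι → ℝ) :
    ∑ i, ∑ j, (p i * g i) * (p j * g j) * M i j ≤ A * ∑ i, p i * g i ^ 2 := by
  have h1 : ∑ i, ∑ j, p i * p j * M i j * g i ^ 2 = A * ∑ i, p i * g i ^ 2 := by
    rw [Finset.mul_sum]
    refine Finset.sum_congr rfl fun i _ => ?_
    calc ∑ j, p i * p j * M i j * g i ^ 2 = (p i * ∑ j, M i j * p j) * g i ^ 2 := by
          rw [Finset.mul_sum, Finset.sum_mul]
          exact Finset.sum_congr rfl fun j _ => by ring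
      _ = A * (p i * g i ^ 2) := by rw [hA]; ring
  have h2 : ∑ i, ∑ j, p i * p j * M i j * g j ^ 2 = A * ∑ i, p i * g i ^ 2 := by
    rw [← h1, Finset.sum_comm]
    exact Finset.sum_congr rfl fun i _ => Finset.sum_congr rfl fun j _ => by
      rw [hs i j]; ring
  have h3 : ∑ i, ∑ j, (p i * g i) * (p j * g j) * M i j ≤
      ∑ i, ∑ j, (p i * p j * M i j * g i ^ 2 + p i * p j * M i j * g j ^ 2) / 2 := by
    refine Finset.sum_le_sum fun i _ => Finset.sum_le_sum fun j _ => ?_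
    have := mul_nonneg (mul_nonneg (hp i) (hp j)) (hM i j)
    nlinarith [mul_nonneg this (sq_nonneg (g i - g j))]
  refine h3.trans_eq ?_
  simp only [← Finset.sum_div, Finset.sum_add_distrib, h1, h2]
  ring

/-! ### Estimates for the real part of the kernel -/

lemma re_one_div_one_sub (a : ℂ) : (1 / (1 - a)).re = (1 - a.re) / ‖1 - a‖ ^ 2 := by
  rw [one_div, Complex.inv_re, Complex.normSq_eq_norm_sq]
  simp

lemma re_one_div_one_sub_nonneg {a : ℂ} (ha : ‖a‖ ≤ 1) : 0 ≤ (1 / (1 - a)).re := by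
  rw [re_one_div_one_sub]
  have := (Complex.re_le_norm a).trans ha
  exact div_nonneg (by linarith) (by positivity)

/-- Comparison of `Re K` at the radius `σ` with `Re K` at the radius `1` and with the Poisson-type
kernel `(1 - τ²) / |1 - τ a|²`. It is used with `a` the inner product of two points of the ball. -/
lemma re_one_div_one_sub_mul_le {a : ℂ} {σ τ : ℝ} (ha : ‖a‖ < 1) (hσ : 0 ≤ σ) (hτ : τ < 1)
    (hστ : σ ≤ τ) (hτσ : τ ^ 2 ≤ σ) :
    (1 / (1 - σ * a)).re ≤
      4 * (1 / (1 - a)).re + 4 * ((1 - τ ^ 2) * ‖1 / (1 - τ * a)‖ ^ 2) := by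
  have hσ1 : σ < 1 := hστ.trans_lt hτ
  have hne : ∀ s : ℝ, 0 ≤ s → s < 1 → 1 - s ≤ ‖1 - s * a‖ := by
    intro s hs hs1
    have h1 := norm_sub_norm_le (1 : ℂ) (s * a)
    rw [norm_one, norm_mul, Complex.norm_real, Real.norm_of_nonneg hs] at h1
    nlinarith [norm_nonneg a]
  have hσpos : 0 < ‖1 - σ * a‖ := lt_of_lt_of_le (by linarith) (hne σ hσ hσ1)
  have hτpos : 0 < ‖1 - τ * a‖ := lt_of_lt_of_le (by linarith) (hne τ (hσ.trans hστ) hτ)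
  have hapos : 0 < ‖1 - a‖ := by
    rw [norm_pos_iff, sub_ne_zero]
    rintro rfl
    simp at ha
  have hcomp : ∀ s : ℝ, σ ≤ s → s ≤ 1 → ‖1 - s * a‖ ≤ 2 * ‖1 - σ * a‖ := by
    intro s h1 h2
    have h3 : (1 : ℂ) - s * a = (1 - σ * a) - ((s - σ : ℝ) : ℂ) * a := by push_cast; ring
    rw [h3]
    refine (norm_sub_le _ _).trans ?_
    rw [norm_mul, Complex.norm_real, Real.norm_of_nonneg (by linarith)]
    have := hne σ hσ hσ1
    nlinarith [norm_nonneg a]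
  have c1 : ‖1 - a‖ ≤ 2 * ‖1 - σ * a‖ := by simpa using hcomp 1 hσ1.le le_rfl
  have c2 : ‖1 - τ * a‖ ≤ 2 * ‖1 - σ * a‖ := hcomp τ hστ hτ.le
  have hre : 0 ≤ 1 - a.re := by linarith [Complex.re_le_norm a]
  -- `Re (1 - σ a) ≤ (1 - σ) + Re (1 - a)`, and the two terms are estimated separately
  have e1 : (1 - a.re) / ‖1 - σ * a‖ ^ 2 ≤ 4 * ((1 - a.re) / ‖1 - a‖ ^ 2) := by
    rw [← mul_div_assoc, div_le_div_iff₀ (by positivity) (by positivity)]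
    nlinarith [mul_le_mul_of_nonneg_left (pow_le_pow_left₀ hapos.le c1 2) hre]
  have e2 : (1 - σ) / ‖1 - σ * a‖ ^ 2 ≤ 4 * ((1 - τ ^ 2) / ‖1 - τ * a‖ ^ 2) := by
    rw [← mul_div_assoc, div_le_div_iff₀ (by positivity) (by positivity)]
    have h1 : 0 ≤ 1 - σ := by linarith
    have h2 := mul_le_mul_of_nonneg_left (pow_le_pow_left₀ hτpos.le c2 2) h1
    have h3 : (1 - σ) * ‖1 - σ * a‖ ^ 2 ≤ (1 - τ ^ 2) * ‖1 - σ * a‖ ^ 2 := by gcongr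
    nlinarith
  rw [re_one_div_one_sub, re_one_div_one_sub, norm_div, norm_one, div_pow, one_pow,
    mul_one_div]
  refine le_trans ?_ (add_le_add e1 e2)
  rw [← add_div]
  gcongr
  simp only [Complex.mul_re, Complex.ofReal_re, Complex.ofReal_im, zero_mul, sub_zero]
  nlinarith

/-! ### The maximal inequality for finite equilibrium measures -/

lemma daKernel_smul_smul (a b : ℝ) (z w : CSpace d) :
    daKernel (a • z) (b • w) = 1 / (1 - ((a * b : ℝ) : ℂ) * inner ℂ w z) := by
  rw [daKernel, RCLike.real_smul_eq_coe_smul (K := ℂ) a, RCLike.real_smul_eq_coe_smul (K := ℂ) b,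
    inner_smul_left, inner_smul_right]
  simp
  ring_nf

lemma norm_inner_le_one {z w : CSpace d} (hz : ‖z‖ ≤ 1) (hw : ‖w‖ ≤ 1) :
    ‖inner ℂ w z‖ ≤ 1 :=
  (norm_inner_le_norm _ _).trans (mul_le_one₀ hw (norm_nonneg _) hz)

lemma daKernel_re_nonneg {z w : CSpace d} (hz : ‖z‖ ≤ 1) (hw : ‖w‖ ≤ 1) :
    0 ≤ (daKernel z w).re :=
  re_one_div_one_sub_nonneg (norm_inner_le_one hz hw)

lemma daKernel_re_comm (z w : CSpace d) : (daKernel z w).re = (daKernel w z).re := by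
  rw [daKernel, daKernel, ← inner_conj_symm w z, ← Complex.conj_re]
  simp

lemma norm_daKernel_comm (z w : CSpace d) : ‖daKernel z w‖ = ‖daKernel w z‖ := by
  rw [daKernel, daKernel, ← inner_conj_symm w z, ← Complex.norm_conj]
  simp

/-- If the potential of the weights `p` is at most `A` on their support, then `p` is a Carleson
measure for `H^2_d` with constant `2 * A`. -/
lemma sum_norm_sq_le_of_row_sums {ι : Type*} [Fintype ι] {y : ι → UnitBall d} {p : ι → ℝ} {A : ℝ}
    (hA0 : 0 ≤ A) (hp : ∀ i, 0 ≤ p i)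
    (hA : ∀ i, p i * ∑ j, (daKernel (y i : CSpace d) (y j : CSpace d)).re * p j = p i * A)
    (f : DruryArveson d) :
    ∑ i, p i * ‖f (y i)‖ ^ 2 ≤ 2 * A * ‖f‖ ^ 2 := by
  have key : ∀ g : DruryArveson d, ∑ i, p i * (g (y i)).re ^ 2 ≤ A * ‖g‖ ^ 2 := by
    intro g
    set S := ∑ i, p i * (g (y i)).re ^ 2 with hS
    have h1 := sq_sum_mul_re_le y (fun i => p i * (g (y i)).re) g
    have h2 := sum_mul_mul_le_of_row_sums
      (M := fun i j => (daKernel (y i : CSpace d) (y j : CSpace d)).re)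
      (fun i j => daKernel_re_nonneg (mem_ball_zero_iff.1 (y i).2).le
        (mem_ball_zero_iff.1 (y j).2).le)
      (fun i j => daKernel_re_comm _ _) hp hA (fun i => (g (y i)).re)
    have h3 : ∑ i, p i * (g (y i)).re * (g (y i)).re = S :=
      Finset.sum_congr rfl fun i _ => by ring
    rw [h3] at h1
    have h4 : S ^ 2 ≤ ‖g‖ ^ 2 * (A * S) :=
      h1.trans (mul_le_mul_of_nonneg_left h2 (by positivity))
    have hS0 : 0 ≤ S := Finset.sum_nonneg fun i _ => mul_nonneg (hp i) (sq_nonneg _)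
    rcases hS0.eq_or_lt with h | h
    · rw [← h]
      positivity
    · nlinarith
  have h1 := key f
  have h2 := key (-Complex.I • f)
  rw [norm_smul] at h2
  have h3 : ∀ i, p i * ‖f (y i)‖ ^ 2 =
      p i * (f (y i)).re ^ 2 + p i * ((-Complex.I • f : DruryArveson d) (y i)).re ^ 2 := by
    intro i
    rw [RKHS.coe_smul, ← Complex.normSq_eq_norm_sq, Complex.normSq_apply]
    simp
    ring
  simp only [h3, Finset.sum_add_distrib]
  simp only [norm_neg, Complex.norm_I, one_mul] at h2
  linarith

/-- The radial maximal inequality for equilibrium weights. The weights `p` are in equilibrium, with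
energy `A`, for the kernel at level `R`, and `|f| ≥ t` at the points `r i • x i`, where the radii
`r i ≤ R ^ 2` are arbitrary. Since `Re K` is not
comparable with `|K|`, the radii are compared through the Carleson estimate for the kernel
functions at the points `(r i * R) • x i`. -/
lemma sq_le_of_le_norm_apply {ι : Type*} [Fintype ι] {x : ι → CSpace d}
    (hx : ∀ i, ‖x i‖ ≤ 1) {R : ℝ} (hR0 : 0 < R) (hR1 : R < 1) {p : ι → ℝ} {A : ℝ}
    (hp : p ∈ stdSimplex ℝ ι)
    (hA : ∀ i, p i * ∑ j, (daKernel (R • x i) (R • x j)).re * p j = p i * A)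
    {y : ι → UnitBall d} {r : ι → ℝ} (hy : ∀ i, (y i : CSpace d) = r i • x i)
    (hr0 : ∀ i, 0 ≤ r i) (hrR : ∀ i, r i ≤ R ^ 2)
    {f : DruryArveson d} {t : ℝ} (ht : 0 ≤ t) (hf : ∀ i, t ≤ ‖f (y i)‖) :
    t ^ 2 ≤ 80 * A * ‖f‖ ^ 2 := by
  have hball : ∀ s : ℝ, 0 ≤ s → s < 1 → ∀ i, s • x i ∈ Metric.ball (0 : CSpace d) 1 := by
    intro s hs hs1 i
    rw [mem_ball_zero_iff, norm_smul, Real.norm_of_nonneg hs]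
    nlinarith [hx i, norm_nonneg (x i)]
  let Y : ι → UnitBall d := fun i => ⟨R • x i, hball R hR0.le hR1 i⟩
  have hr1 : ∀ i, r i < 1 := fun i => (hrR i).trans_lt (by nlinarith)
  let W : ι → UnitBall d := fun i => ⟨(r i * R) • x i,
    hball _ (mul_nonneg (hr0 i) hR0.le) (by nlinarith [hr1 i, hr0 i]) i⟩
  set T : ι → ι → ℝ := fun i j => (1 - r i ^ 2) * ‖kernelFunction (W i) (Y j)‖ ^ 2 with hT
  set M : ι → ι → ℝ := fun i j => (daKernel (R • x i) (R • x j)).re with hM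
  have hMsum : ∑ i, ∑ j, p i * p j * M i j = A := by
    have : ∀ i, ∑ j, p i * p j * M i j = p i * A := by
      intro i
      rw [← hA, Finset.mul_sum]
      exact Finset.sum_congr rfl fun j _ => by rw [hM]; ring
    simp only [this, ← Finset.sum_mul, hp.2, one_mul]
  have hM0 : ∀ i j, 0 ≤ M i j := fun i j =>
    daKernel_re_nonneg (mem_ball_zero_iff.1 (Y i).2).le (mem_ball_zero_iff.1 (Y j).2).le
  have hA0 : 0 ≤ A := hMsum ▸ Finset.sum_nonneg fun i _ => Finset.sum_nonneg fun j _ =>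
    mul_nonneg (mul_nonneg (hp.1 i) (hp.1 j)) (hM0 i j)
  have hTrow : ∀ i, ∑ j, p j * T i j ≤ 2 * A := by
    intro i
    have h1 := sum_norm_sq_le_of_row_sums (y := Y) hA0 hp.1 hA (kernelFunction (W i))
    have h2 : ‖(W i : CSpace d)‖ ^ 2 ≤ r i ^ 2 := by
      refine pow_le_pow_left₀ (norm_nonneg _) ?_ 2
      change ‖(r i * R) • x i‖ ≤ r i
      rw [norm_smul, Real.norm_of_nonneg (mul_nonneg (hr0 i) hR0.le), mul_assoc]
      exact mul_le_of_le_one_right (hr0 i) (mul_le_one₀ hR1.le (norm_nonneg _) (hx i))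
    have h3 : 0 < 1 - r i ^ 2 := by nlinarith [hr0 i, hr1 i]
    rw [norm_sq_kernelFunction, mul_one_div, le_div_iff₀ (by linarith)] at h1
    have h4 : ∑ j, p j * T i j = (∑ j, p j * ‖kernelFunction (W i) (Y j)‖ ^ 2) * (1 - r i ^ 2) := by
      rw [Finset.sum_mul]
      exact Finset.sum_congr rfl fun j _ => by rw [hT]; ring
    rw [h4]
    refine le_trans (mul_le_mul_of_nonneg_left (by linarith) ?_) h1
    exact Finset.sum_nonneg fun j _ => mul_nonneg (hp.1 j) (sq_nonneg _)
  have hT0 : ∀ i j, 0 ≤ T i j := fun i j =>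
    mul_nonneg (by nlinarith [hr0 i, hr1 i]) (by positivity)
  have hcmp : ∀ i j, r i ≤ r j →
      (daKernel (y i : CSpace d) (y j : CSpace d)).re ≤ 4 * M i j + 4 * T i j := by
    intro i j hij
    have ha : ‖((R * R : ℝ) : ℂ) * inner ℂ (x j) (x i)‖ < 1 := by
      rw [norm_mul, Complex.norm_real, Real.norm_of_nonneg (by positivity)]
      nlinarith [norm_inner_le_one (hx i) (hx j), norm_nonneg (inner ℂ (x j) (x i))]
    have h1 := re_one_div_one_sub_mul_le (σ := r i * r j / R ^ 2) (τ := r i) ha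
      (div_nonneg (mul_nonneg (hr0 i) (hr0 j)) (by positivity)) (hr1 i)
      (by
        rw [div_le_iff₀ (by positivity)]
        exact mul_le_mul_of_nonneg_left (hrR j) (hr0 i))
      (by
        rw [le_div_iff₀ (by positivity)]
        have : r i ^ 2 ≤ r i * r j := by nlinarith [hr0 i]
        exact (mul_le_of_le_one_right (sq_nonneg _) (by nlinarith)).trans this)
    have e1 : daKernel (y i : CSpace d) (y j : CSpace d) =
        1 / (1 - ((r i * r j / R ^ 2 : ℝ) : ℂ) * (((R * R : ℝ) : ℂ) * inner ℂ (x j) (x i))) := by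
      rw [hy, hy, daKernel_smul_smul, ← mul_assoc, ← Complex.ofReal_mul]
      congr 4
      field_simp
    have e2 : M i j = (1 / (1 - ((R * R : ℝ) : ℂ) * inner ℂ (x j) (x i))).re := by
      rw [hM]
      simp only [daKernel_smul_smul]
    have e3 : ‖kernelFunction (W i) (Y j)‖ =
        ‖1 / (1 - ((r i : ℝ) : ℂ) * (((R * R : ℝ) : ℂ) * inner ℂ (x j) (x i)))‖ := by
      rw [kernelFunction_apply, norm_daKernel_comm]
      change ‖daKernel ((r i * R) • x i) (R • x j)‖ = _
      rw [daKernel_smul_smul, ← mul_assoc, ← Complex.ofReal_mul, mul_assoc]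
    rw [e1, e2, hT]
    simp only [e3]
    exact h1
  have hcmp' : ∀ i j, (daKernel (y i : CSpace d) (y j : CSpace d)).re ≤
      4 * M i j + 4 * (T i j + T j i) := by
    intro i j
    rcases le_total (r i) (r j) with h | h
    · linarith [hcmp i j h, hT0 j i]
    · rw [daKernel_re_comm]
      have : M i j = M j i := daKernel_re_comm _ _
      linarith [hcmp j i h, hT0 i j]
  have hTsum : ∑ i, ∑ j, p i * p j * T i j ≤ 2 * A := by
    calc ∑ i, ∑ j, p i * p j * T i j = ∑ i, p i * ∑ j, p j * T i j := by
          simp only [Finset.mul_sum, mul_assoc]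
      _ ≤ ∑ i, p i * (2 * A) :=
          Finset.sum_le_sum fun i _ => mul_le_mul_of_nonneg_left (hTrow i) (hp.1 i)
      _ = 2 * A := by rw [← Finset.sum_mul, hp.2, one_mul]
  have hksum : ∑ i, ∑ j, p i * p j * (daKernel (y i : CSpace d) (y j : CSpace d)).re ≤
      20 * A := by
    have hTsum' : ∑ i, ∑ j, p i * p j * T j i ≤ 2 * A := by
      rw [Finset.sum_comm]
      simpa only [mul_comm (p _) (p _)] using hTsum
    calc _ ≤ ∑ i, ∑ j, (4 * (p i * p j * M i j) + 4 * (p i * p j * T i j) +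
            4 * (p i * p j * T j i)) := by
          refine Finset.sum_le_sum fun i _ => Finset.sum_le_sum fun j _ => ?_
          have := mul_le_mul_of_nonneg_left (hcmp' i j) (mul_nonneg (hp.1 i) (hp.1 j))
          linarith
      _ = 4 * (∑ i, ∑ j, p i * p j * M i j) + 4 * (∑ i, ∑ j, p i * p j * T i j) +
            4 * (∑ i, ∑ j, p i * p j * T j i) := by
          simp only [Finset.sum_add_distrib, Finset.mul_sum]
      _ ≤ 20 * A := by linarith
  -- the signs may be dropped because `Re K ≥ 0`
  have key : ∀ g : DruryArveson d, (∑ i, p i * |(g (y i)).re|) ^ 2 ≤ 20 * A * ‖g‖ ^ 2 := by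
    intro g
    have h1 := sq_sum_mul_re_le y (fun i => p i * SignType.sign (g (y i)).re) g
    have h2 : ∑ i, p i * SignType.sign (g (y i)).re * (g (y i)).re =
        ∑ i, p i * |(g (y i)).re| :=
      Finset.sum_congr rfl fun i _ => by rw [mul_assoc, sign_mul_self]
    rw [h2] at h1
    refine h1.trans ?_
    rw [mul_comm]
    refine mul_le_mul_of_nonneg_right (le_trans ?_ hksum) (by positivity)
    refine Finset.sum_le_sum fun i _ => Finset.sum_le_sum fun j _ => ?_
    have hk := daKernel_re_nonneg (mem_ball_zero_iff.1 (y i).2).le (mem_ball_zero_iff.1 (y j).2).le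
    refine mul_le_mul_of_nonneg_right ?_ hk
    have hs : ((SignType.sign (g (y i)).re : ℝ)) * (SignType.sign (g (y j)).re : ℝ) ≤ 1 := by
      rcases SignType.sign (g (y i)).re with _ | _ | _ <;>
        rcases SignType.sign (g (y j)).re with _ | _ | _ <;> norm_num
    nlinarith [mul_le_mul_of_nonneg_left hs (mul_nonneg (hp.1 i) (hp.1 j))]
  have h1 := key f
  have h2 := key (-Complex.I • f)
  rw [norm_smul] at h2
  have h3 : t ≤ ∑ i, p i * |(f (y i)).re| +
      ∑ i, p i * |((-Complex.I • f : DruryArveson d) (y i)).re| := by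
    calc t = ∑ i, p i * t := by rw [← Finset.sum_mul, hp.2, one_mul]
      _ ≤ ∑ i, (p i * |(f (y i)).re| +
          p i * |((-Complex.I • f : DruryArveson d) (y i)).re|) := by
        refine Finset.sum_le_sum fun i _ => ?_
        rw [← mul_add]
        refine mul_le_mul_of_nonneg_left ((hf i).trans ?_) (hp.1 i)
        have := Complex.norm_le_abs_re_add_abs_im (f (y i))
        rw [RKHS.coe_smul]
        simpa using this
      _ = _ := Finset.sum_add_distrib
  simp only [norm_neg, Complex.norm_I, one_mul] at h2
  have := sq_le_sq' (by linarith) h3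
  nlinarith [sq_nonneg (∑ i, p i * |(f (y i)).re| -
      ∑ i, p i * |((-Complex.I • f : DruryArveson d) (y i)).re|)]

/-! ### Kernel functions on the whole space -/

lemma continuous_kernelFunction : Continuous (kernelFunction : UnitBall d → DruryArveson d) := by
  refine continuous_iff_continuousAt.2 fun w => ?_
  rw [ContinuousAt, tendsto_iff_norm_sub_tendsto_zero]
  have h1 : ∀ z : UnitBall d, ‖kernelFunction z - kernelFunction w‖ ^ 2 =
      1 / (1 - ‖(z : CSpace d)‖ ^ 2) - 2 * (daKernel (z : CSpace d) (w : CSpace d)).re +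
        1 / (1 - ‖(w : CSpace d)‖ ^ 2) := by
    intro z
    rw [@norm_sub_sq ℂ, norm_sq_kernelFunction, norm_sq_kernelFunction, inner_kernelFunction,
      kernelFunction_apply]
    rfl
  have hw : ‖(w : CSpace d)‖ < 1 := mem_ball_zero_iff.1 w.2
  have h2 : Tendsto (fun z : UnitBall d => ‖kernelFunction z - kernelFunction w‖ ^ 2) (𝓝 w)
      (𝓝 (1 / (1 - ‖(w : CSpace d)‖ ^ 2) - 2 * (daKernel (w : CSpace d) (w : CSpace d)).re +
        1 / (1 - ‖(w : CSpace d)‖ ^ 2))) := by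
    simp only [h1, daKernel]
    have hz : Tendsto (fun z : UnitBall d => (z : CSpace d)) (𝓝 w) (𝓝 (w : CSpace d)) :=
      continuous_subtype_val.tendsto w
    refine ((Tendsto.div tendsto_const_nhds (tendsto_const_nhds.sub (hz.norm.pow 2))
      (by nlinarith [norm_nonneg (w : CSpace d)])).sub
      (((Complex.continuous_re.tendsto _).comp (Tendsto.div tendsto_const_nhds
        (tendsto_const_nhds.sub (tendsto_const_nhds.inner hz)) ?_)).const_mul 2)).add
      tendsto_const_nhds
    intro h
    have := norm_inner_ball_lt_one w w
    rw [← sub_eq_zero.1 h] at this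
    simp at this
  rw [← h1 w] at h2
  simpa using h2.sqrt

/-- The kernel function at a point, extended by `0` to points outside the ball, so that
`inner ℂ (kernelExt x) f` is the extension of `f` by `0`. -/
def kernelExt (x : CSpace d) : DruryArveson d :=
  Function.extend (Subtype.val : UnitBall d → CSpace d) kernelFunction 0 x

lemma kernelExt_coe (z : UnitBall d) : kernelExt (z : CSpace d) = kernelFunction z :=
  Subtype.val_injective.extend_apply _ _ _

lemma kernelExt_of_notMem {x : CSpace d} (hx : x ∉ Metric.ball (0 : CSpace d) 1) :
    kernelExt x = 0 :=
  Function.extend_apply' _ _ _ fun ⟨z, hz⟩ => hx (hz ▸ z.2)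

lemma extend_eq_inner_kernelExt (f : DruryArveson d) :
    Function.extend (Subtype.val : UnitBall d → CSpace d) (fun z => f z) 0 =
      fun x => inner ℂ (kernelExt x) f := by
  ext x
  by_cases hx : x ∈ Metric.ball (0 : CSpace d) 1
  · lift x to UnitBall d using hx
    rw [Subtype.val_injective.extend_apply, kernelExt_coe, inner_kernelFunction]
  · rw [kernelExt_of_notMem hx, inner_zero_left]
    exact Function.extend_apply' _ _ _ fun ⟨z, hz⟩ => hx (hz ▸ z.2)

lemma hasRadialLimit_iff {f : DruryArveson d} {ζ : CSpace d} {c : ℂ} :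
    HasRadialLimit f ζ c ↔
      Tendsto (fun r : ℝ => inner ℂ (kernelExt (r • ζ)) f) (𝓝[<] 1) (𝓝 c) := by
  rw [HasRadialLimit, extend_eq_inner_kernelExt]

lemma continuousOn_kernelExt :
    ContinuousOn (kernelExt : CSpace d → DruryArveson d) (Metric.ball 0 1) := by
  rw [continuousOn_iff_continuous_domRestrict]
  convert! continuous_kernelFunction (d := d) using 1
  ext1 z
  exact kernelExt_coe z

lemma smul_mem_ball {R : ℝ} (hR0 : 0 ≤ R) (hR1 : R < 1) {z : CSpace d} (hz : ‖z‖ ≤ 1) :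
    R • z ∈ Metric.ball (0 : CSpace d) 1 := by
  rw [mem_ball_zero_iff, norm_smul, Real.norm_of_nonneg hR0]
  nlinarith [norm_nonneg z]

lemma inner_kernelExt_kernelExt {z w : CSpace d} (hz : z ∈ Metric.ball (0 : CSpace d) 1)
    (hw : w ∈ Metric.ball (0 : CSpace d) 1) :
    inner ℂ (kernelExt z) (kernelExt w) = daKernel z w := by
  lift z to UnitBall d using hz
  lift w to UnitBall d using hw
  rw [kernelExt_coe, kernelExt_coe, inner_kernelFunction, kernelFunction_apply]

/-! ### Energy as a norm -/

lemma integrable_kernelExt_smul {R : ℝ} (hR : R ∈ Set.Ico (0 : ℝ) 1) {μ : Measure (CSpace d)}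
    [IsFiniteMeasure μ] (hμ : ∀ᵐ z ∂μ, ‖z‖ ≤ 1) :
    Integrable (fun z => kernelExt (R • z)) μ := by
  have h : IntegrableOn (fun z => kernelExt (R • z)) (Metric.closedBall (0 : CSpace d) 1) μ := by
    refine ContinuousOn.integrableOn_compact (isCompact_closedBall _ _) ?_
    exact continuousOn_kernelExt.comp (by fun_prop) fun z hz =>
      smul_mem_ball hR.1 hR.2 (mem_closedBall_zero_iff.1 hz)
  rwa [IntegrableOn, Measure.restrict_eq_self_of_ae_mem] at h
  filter_upwards [hμ] with z hz using mem_closedBall_zero_iff.2 hz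

lemma re_inner_integral_kernelExt {R : ℝ} (hR : R ∈ Set.Ico (0 : ℝ) 1)
    {μ ν : Measure (CSpace d)} [IsFiniteMeasure μ] [IsFiniteMeasure ν]
    (hμ : ∀ᵐ z ∂μ, ‖z‖ ≤ 1) (hν : ∀ᵐ z ∂ν, ‖z‖ ≤ 1) :
    (inner ℂ (∫ z, kernelExt (R • z) ∂ν) (∫ z, kernelExt (R • z) ∂μ)).re =
      ∫ z, ∫ w, (daKernel (R • z) (R • w)).re ∂ν ∂μ := by
  set v := ∫ z, kernelExt (R • z) ∂ν with hv
  have hiν := integrable_kernelExt_smul hR hν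
  have hiμ := integrable_kernelExt_smul hR hμ
  have h1 : ∀ᵐ z ∂μ, ∫ w, (daKernel (R • z) (R • w)).re ∂ν =
      (inner ℂ v (kernelExt (R • z))).re := by
    filter_upwards [hμ] with z hz
    rw [← inner_conj_symm, Complex.conj_re, hv, ← integral_inner hiν]
    refine Eq.trans ?_ (integral_re (𝕜 := ℂ) (hiν.const_inner (𝕜 := ℂ) (kernelExt (R • z))))
    refine integral_congr_ae ?_
    filter_upwards [hν] with w hw
    rw [inner_kernelExt_kernelExt (smul_mem_ball hR.1 hR.2 hz) (smul_mem_ball hR.1 hR.2 hw)]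
    rfl
  rw [integral_congr_ae h1, ← integral_inner hiμ]
  exact (integral_re (𝕜 := ℂ) (hiμ.const_inner (𝕜 := ℂ) v)).symm

/-- The energy at level `R` of a measure on the closed ball is the squared norm of the functional
`f ↦ ∫ f (R z) dμ`. -/
lemma norm_sq_integral_kernelExt {R : ℝ} (hR : R ∈ Set.Ico (0 : ℝ) 1)
    {μ : Measure (CSpace d)} [IsFiniteMeasure μ] (hμ : ∀ᵐ z ∂μ, ‖z‖ ≤ 1) :
    ‖∫ z, kernelExt (R • z) ∂μ‖ ^ 2 = ∫ z, ∫ w, (daKernel (R • z) (R • w)).re ∂μ ∂μ := by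
  rw [← re_inner_integral_kernelExt hR hμ hμ, inner_self_eq_norm_sq_to_K]
  simp only [Complex.coe_algebraMap]
  norm_cast

lemma energy_eq_iSup {μ : Measure (CSpace d)} [IsFiniteMeasure μ] (hμ : ∀ᵐ z ∂μ, ‖z‖ ≤ 1) :
    energy μ = ⨆ R ∈ Set.Ico (0 : ℝ) 1,
      ENNReal.ofReal (‖∫ z, kernelExt (R • z) ∂μ‖ ^ 2) :=
  iSup_congr fun _ => iSup_congr fun hR => by rw [norm_sq_integral_kernelExt hR hμ]

/-- Restriction of a measure decreases the energy, because `Re K ≥ 0`. -/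
lemma norm_setIntegral_kernelExt_le {R : ℝ} (hR : R ∈ Set.Ico (0 : ℝ) 1)
    {μ : Measure (CSpace d)} [IsFiniteMeasure μ] (hμ : ∀ᵐ z ∂μ, ‖z‖ ≤ 1) {K : Set (CSpace d)}
    (hK : MeasurableSet K) :
    ‖∫ z in K, kernelExt (R • z) ∂μ‖ ^ 2 ≤ ‖∫ z, kernelExt (R • z) ∂μ‖ ^ 2 := by
  rw [← integral_add_compl hK (integrable_kernelExt_smul hR hμ), @norm_add_sq ℂ]
  have h1 := re_inner_integral_kernelExt hR (ae_restrict_of_ae (s := Kᶜ) hμ)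
    (ae_restrict_of_ae (s := K) hμ)
  have h2 : 0 ≤ ∫ z in Kᶜ, ∫ w in K, (daKernel (R • z) (R • w)).re ∂μ ∂μ := by
    refine integral_nonneg_of_ae ?_
    filter_upwards [ae_restrict_of_ae (s := Kᶜ) hμ] with z hz
    refine integral_nonneg_of_ae ?_
    filter_upwards [ae_restrict_of_ae (s := K) hμ] with w hw
    exact daKernel_re_nonneg (mem_ball_zero_iff.1 (smul_mem_ball hR.1 hR.2 hz)).le
      (mem_ball_zero_iff.1 (smul_mem_ball hR.1 hR.2 hw)).le
  rw [← h1] at h2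
  have h3 : RCLike.re (inner ℂ (∫ z in K, kernelExt (R • z) ∂μ)
    (∫ z in Kᶜ, kernelExt (R • z) ∂μ)) = (inner ℂ (∫ z in K, kernelExt (R • z) ∂μ)
    (∫ z in Kᶜ, kernelExt (R • z) ∂μ)).re := rfl
  rw [h3]
  nlinarith [sq_nonneg ‖∫ z in Kᶜ, kernelExt (R • z) ∂μ‖]

/-! ### The capacitary weak type inequality -/

/-- The set of points where the radial maximal function exceeds `t`. -/
def radialSuperlevelSet (f : DruryArveson d) (t : ℝ) : Set (CSpace d) :=
  {z | ∃ r ∈ Set.Ioo (0 : ℝ) 1, t < ‖inner ℂ (kernelExt (r • z)) f‖}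

lemma isOpen_lt_norm_inner_kernelExt (f : DruryArveson d) {t : ℝ} (ht : 0 ≤ t) :
    IsOpen {x : CSpace d | t < ‖inner ℂ (kernelExt x) f‖} := by
  have h := (ContinuousOn.inner (𝕜 := ℂ) (continuousOn_kernelExt (d := d))
    (continuousOn_const (c := f))).norm.isOpen_inter_preimage Metric.isOpen_ball
    (isOpen_Ioi (a := t))
  convert! h using 1
  ext x
  refine ⟨fun hx => ⟨?_, hx⟩, fun hx => hx.2⟩
  by_contra hxb
  rw [Set.mem_ofPred_eq, kernelExt_of_notMem hxb, inner_zero_left, norm_zero] at hx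
  exact absurd hx ht.not_gt

lemma radialSuperlevelSet_eq (f : DruryArveson d) (t : ℝ) :
    radialSuperlevelSet f t = ⋃ r : Set.Ioo (0 : ℝ) 1,
      (fun z => (r : ℝ) • z) ⁻¹' {x : CSpace d | t < ‖inner ℂ (kernelExt x) f‖} := by
  ext z
  simp [radialSuperlevelSet]

lemma isOpen_radialSuperlevelSet (f : DruryArveson d) {t : ℝ} (ht : 0 ≤ t) :
    IsOpen (radialSuperlevelSet f t) := by
  rw [radialSuperlevelSet_eq]
  exact isOpen_iUnion fun r =>
    (isOpen_lt_norm_inner_kernelExt f ht).preimage (by fun_prop)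

/-- On a compact set, the radial maximal function exceeds `t` already at radii away from `1`. -/
lemma exists_radius_bound {f : DruryArveson d} {t : ℝ} (ht : 0 ≤ t) {F : Set (CSpace d)}
    (hF : IsCompact F) (hFs : F ⊆ radialSuperlevelSet f t) :
    ∃ s ∈ Set.Ioo (0 : ℝ) 1, ∀ z ∈ F, ∃ r ∈ Set.Ioc (0 : ℝ) s,
      t < ‖inner ℂ (kernelExt (r • z)) f‖ := by
  rw [radialSuperlevelSet_eq] at hFs
  obtain ⟨T, hT⟩ := hF.elim_finite_subcover _
    (fun r : Set.Ioo (0 : ℝ) 1 => (isOpen_lt_norm_inner_kernelExt f ht).preimage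
      (by fun_prop : Continuous fun z : CSpace d => (r : ℝ) • z)) hFs
  have : Nonempty (Set.Ioo (0 : ℝ) 1) := ⟨⟨1 / 2, by norm_num⟩⟩
  obtain ⟨s, hs⟩ := T.exists_le
  refine ⟨s, s.2, fun z hz => ?_⟩
  obtain ⟨r, hr, hzr⟩ := Set.mem_iUnion₂.1 (hT hz)
  exact ⟨r, ⟨r.2.1, hs r hr⟩, hzr⟩

/-- A convex combination of kernel functions at points `R • z` has at least the energy of the
equilibrium weights on its finitely many nodes, to which the maximal inequality applies. -/
lemma sq_le_norm_sq_of_mem_convexHull {f : DruryArveson d} {t R : ℝ} (ht : 0 ≤ t)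
    (hR0 : 0 < R) (hR1 : R < 1) {F : Set (CSpace d)} (hF : ∀ z ∈ F, ‖z‖ ≤ 1)
    (hFr : ∀ z ∈ F, ∃ r ∈ Set.Ioc (0 : ℝ) (R ^ 2), t < ‖inner ℂ (kernelExt (r • z)) f‖)
    {v : DruryArveson d} (hv : v ∈ convexHull ℝ ((fun z => kernelExt (R • z)) '' F)) :
    t ^ 2 ≤ 80 * ‖f‖ ^ 2 * ‖v‖ ^ 2 := by
  obtain ⟨ι, hι, q, g, hq0, hq1, hg, rfl⟩ := mem_convexHull_iff_exists_fintype.1 hv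
  choose x hxF hx using hg
  choose r hr hrt using fun i => hFr (x i) (hxF i)
  have hRb : ∀ i, R • x i ∈ Metric.ball (0 : CSpace d) 1 := fun i =>
    smul_mem_ball hR0.le hR1 (hF _ (hxF i))
  have : Nonempty ι := by
    by_contra h
    rw [not_nonempty_iff] at h
    simp at hq1
  set M : Matrix ι ι ℝ := fun i j => (daKernel (R • x i) (R • x j)).re with hM
  obtain ⟨p, hp, hmin, hA⟩ := exists_minimizer_stdSimplex M
    (by ext i j; exact daKernel_re_comm _ _)
  have h1 : p ⬝ᵥ M.mulVec p ≤ ‖∑ i, q i • g i‖ ^ 2 := by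
    refine (hmin q ⟨hq0, hq1⟩).trans_eq ?_
    rw [← @inner_self_eq_norm_sq ℂ]
    have hg : ∀ i, q i • g i = (q i : ℂ) • kernelExt (R • x i) := fun i => by
      rw [← hx, Complex.coe_smul]
    simp only [hg, sum_inner, inner_sum, inner_smul_left, inner_smul_right,
      inner_kernelExt_kernelExt (hRb _) (hRb _), Complex.conj_ofReal, RCLike.re_to_complex,
      Complex.re_sum, Complex.re_ofReal_mul]
    simp only [dotProduct, Matrix.mulVec, Finset.mul_sum, hM]
    refine Finset.sum_congr rfl fun i _ => Finset.sum_congr rfl fun j _ => ?_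
    rw [daKernel_re_comm]
    ring
  have h2 := sq_le_of_le_norm_apply (fun i => hF _ (hxF i)) hR0 hR1 hp hA
    (y := fun i => ⟨r i • x i, smul_mem_ball (hr i).1.le
      ((hr i).2.trans_lt (by nlinarith)) (hF _ (hxF i))⟩) (r := r) (fun i => rfl)
    (fun i => (hr i).1.le) (fun i => (hr i).2) ht (f := f) fun i => by
      rw [← inner_kernelFunction, ← kernelExt_coe]
      exact (hrt i).le
  nlinarith [mul_le_mul_of_nonneg_right h1 (sq_nonneg ‖f‖)]

lemma sq_le_mul_energy {f : DruryArveson d} {t : ℝ} (ht : 0 ≤ t) {F : Set (CSpace d)}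
    (hF : IsCompact F) (hFs : F ⊆ radialSuperlevelSet f t ∩ Metric.closedBall 0 1)
    {μ : Measure (CSpace d)} [IsProbabilityMeasure μ] (hμ : μ Fᶜ = 0) :
    ∃ E : ℝ, ENNReal.ofReal E ≤ energy μ ∧ t ^ 2 ≤ 80 * ‖f‖ ^ 2 * E := by
  have hF1 : ∀ z ∈ F, ‖z‖ ≤ 1 := fun z hz => mem_closedBall_zero_iff.1 (hFs hz).2
  have hμF : ∀ᵐ z ∂μ, z ∈ F := hμ
  have hμ1 : ∀ᵐ z ∂μ, ‖z‖ ≤ 1 := hμF.mono hF1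
  obtain ⟨s, hs, hsF⟩ := exists_radius_bound ht hF (fun z hz => (hFs hz).1)
  -- any `R < 1` with `s ≤ R ^ 2` will do
  set R := (1 + s) / 2 with hRdef
  have hR0 : 0 < R := by linarith [hs.1]
  have hR1 : R < 1 := by linarith [hs.2]
  have hsR : s ≤ R ^ 2 := by nlinarith [sq_nonneg (1 - s)]
  refine ⟨‖∫ z, kernelExt (R • z) ∂μ‖ ^ 2, ?_, ?_⟩
  · rw [energy_eq_iSup hμ1]
    exact le_iSup₂_of_le R ⟨hR0.le, hR1⟩ le_rfl
  · have hmem : ∫ z, kernelExt (R • z) ∂μ ∈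
        closure (convexHull ℝ ((fun z => kernelExt (R • z)) '' F)) := by
      refine (convex_convexHull ℝ _).closure.integral_mem isClosed_closure ?_
        (integrable_kernelExt_smul ⟨hR0.le, hR1⟩ hμ1)
      filter_upwards [hμF] with z hz
      exact subset_closure (subset_convexHull ℝ _ ⟨z, hz, rfl⟩)
    refine closure_minimal (s := convexHull ℝ ((fun z => kernelExt (R • z)) '' F))
      (t := {v | t ^ 2 ≤ 80 * ‖f‖ ^ 2 * ‖v‖ ^ 2}) (fun v hv => ?_)
      (isClosed_le (by fun_prop) (by fun_prop)) hmem
    refine sq_le_norm_sq_of_mem_convexHull ht hR0 hR1 hF1 (fun z hz => ?_) hv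
    obtain ⟨r, hr, h⟩ := hsF z hz
    exact ⟨r, ⟨hr.1, hr.2.trans hsR⟩, h⟩

/-- The capacitary weak type inequality for the radial maximal function. -/
lemma innerCapacity_radialSuperlevelSet_le (f : DruryArveson d) {t : ℝ} (ht : 0 < t) :
    innerCapacity (radialSuperlevelSet f t ∩ Metric.closedBall 0 1) ≤
      ENNReal.ofReal (80 * ‖f‖ ^ 2 / t ^ 2) := by
  refine iSup_le fun F => iSup₂_le fun hFs hF => iSup_le fun μ => iSup₂_le fun hμ1 hμF => ?_
  obtain ⟨E, hE, hle⟩ := sq_le_mul_energy ht.le hF hFs hμF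
  have hE0 : 0 < E := by
    by_contra h
    push Not at h
    nlinarith [mul_nonneg (sq_nonneg ‖f‖) (neg_nonneg.2 h), pow_pos ht 2]
  calc (energy μ)⁻¹ ≤ (ENNReal.ofReal E)⁻¹ := ENNReal.inv_le_inv.2 hE
    _ = ENNReal.ofReal E⁻¹ := (ENNReal.ofReal_inv_of_pos hE0).symm
    _ ≤ _ := by
      refine ENNReal.ofReal_le_ofReal ?_
      rw [inv_eq_one_div, div_le_div_iff₀ hE0 (by positivity)]
      linarith

lemma outerCapacity_le_of_subset_radialSuperlevelSet {f : DruryArveson d} {t : ℝ} (ht : 0 < t)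
    {E : Set (CSpace d)} (hE : E ⊆ radialSuperlevelSet f t) :
    outerCapacity E ≤ ENNReal.ofReal (80 * ‖f‖ ^ 2 / t ^ 2) :=
  iInf_le_of_le _ (iInf₂_le_of_le (isOpen_radialSuperlevelSet f ht.le) hE
    (innerCapacity_radialSuperlevelSet_le f ht))

/-! ### Countable unions of sets of outer capacity zero -/

lemma outerCapacity_mono {E E' : Set (CSpace d)} (h : E ⊆ E') :
    outerCapacity E ≤ outerCapacity E' :=
  le_iInf fun G => le_iInf₂ fun hG hEG =>
    iInf_le_of_le G (iInf₂_le_of_le hG (h.trans hEG) le_rfl)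

/-- The measure of a compact set is controlled by its capacity and the energy of the measure: compare
with the normalized restriction of `μ` to `K`. -/
lemma measure_sq_le_of_innerCapacity_le {μ : Measure (CSpace d)} [IsProbabilityMeasure μ]
    (hμ : ∀ᵐ z ∂μ, ‖z‖ ≤ 1) {x : ℝ} (hx0 : 0 ≤ x) (hx : energy μ ≤ ENNReal.ofReal x)
    {G K : Set (CSpace d)} {c : ℝ} (hc0 : 0 ≤ c)
    (hc : innerCapacity G ≤ ENNReal.ofReal c) (hK : IsCompact K) (hKG : K ⊆ G) :
    μ.real K ^ 2 ≤ c * x := by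
  rcases eq_or_ne (μ K) 0 with h0 | h0
  · simp only [Measure.real, h0, ENNReal.toReal_zero]
    simpa using mul_nonneg hc0 hx0
  have hm : 0 < μ.real K := ENNReal.toReal_pos h0 (measure_ne_top _ _)
  set m := μ.real K with hmdef
  have hmK : μ K = ENNReal.ofReal m := by rw [hmdef, ofReal_measureReal]
  set ν := ProbabilityTheory.cond μ K with hν
  have hνp : IsProbabilityMeasure ν := ProbabilityTheory.cond_isProbabilityMeasure h0
  have hνdef : ν = (μ K)⁻¹ • μ.restrict K := rfl
  have hνK : ν Kᶜ = 0 := by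
    rw [hνdef, Measure.smul_apply, Measure.restrict_apply hK.measurableSet.compl]
    simp
  have hν1 : ∀ᵐ z ∂ν, ‖z‖ ≤ 1 := by
    rw [hνdef]
    exact Measure.ae_smul_measure (ae_restrict_of_ae hμ) _
  have hE : energy ν ≤ ENNReal.ofReal (x / m ^ 2) := by
    rw [energy_eq_iSup hν1]
    refine iSup₂_le fun R hR => ENNReal.ofReal_le_ofReal ?_
    rw [hνdef, integral_smul_measure, norm_smul, mul_pow, hmK, ENNReal.toReal_inv,
      ENNReal.toReal_ofReal hm.le, Real.norm_of_nonneg (by positivity), div_eq_inv_mul, inv_pow]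
    refine mul_le_mul_of_nonneg_left ?_ (by positivity)
    refine (norm_setIntegral_kernelExt_le hR hμ hK.measurableSet).trans ?_
    rw [energy_eq_iSup hμ] at hx
    exact (ENNReal.ofReal_le_ofReal_iff hx0).1 ((le_iSup₂_of_le R hR le_rfl).trans hx)
  have h1 : (energy ν)⁻¹ ≤ ENNReal.ofReal c :=
    le_trans (le_iSup_of_le K (le_iSup₂_of_le hKG hK (le_iSup_of_le ν
      (le_iSup₂ (f := fun (_ : IsProbabilityMeasure ν) (_ : ν Kᶜ = 0) => (energy ν)⁻¹)
        hνp hνK)))) hc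
  have h2 : (ENNReal.ofReal (x / m ^ 2))⁻¹ ≤ ENNReal.ofReal c :=
    (ENNReal.inv_le_inv.2 hE).trans h1
  have hxm : 0 < x / m ^ 2 := by
    by_contra h
    rw [ENNReal.ofReal_eq_zero.2 (not_lt.1 h), ENNReal.inv_zero] at h2
    exact absurd h2 (by simp)
  rw [← ENNReal.ofReal_inv_of_pos hxm, ENNReal.ofReal_le_ofReal_iff hc0, inv_div,
    div_le_iff₀ ((div_pos_iff_of_pos_right (by positivity)).1 hxm)] at h2
  exact h2

/-- The square root of the capacity is countably subadditive on open sets: a measure on a compact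
subset of `⋃ n, G n` gives each `G n` a mass of at most the square root of capacity times energy. -/
lemma outerCapacity_iUnion_eq_zero {E : ℕ → Set (CSpace d)} (hE : ∀ n, outerCapacity (E n) = 0) :
    outerCapacity (⋃ n, E n) = 0 := by
  have key : ∀ ε : ℝ, 0 < ε → outerCapacity (⋃ n, E n) ≤ ENNReal.ofReal (ε ^ 2) := by
    intro ε hε
    have hex : ∀ n, ∃ G : Set (CSpace d), IsOpen G ∧ E n ⊆ G ∧
        innerCapacity (G ∩ Metric.closedBall 0 1) ≤
          ENNReal.ofReal ((ε * (1 / 2) ^ (n + 1)) ^ 2) := by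
      intro n
      have h : outerCapacity (E n) < ENNReal.ofReal ((ε * (1 / 2) ^ (n + 1)) ^ 2) := by
        rw [hE, ENNReal.ofReal_pos]
        positivity
      simp only [outerCapacity, iInf_lt_iff] at h
      obtain ⟨G, hG, hEG, hlt⟩ := h
      exact ⟨G, hG, hEG, hlt.le⟩
    choose G hG hEG hcap using hex
    refine iInf_le_of_le (⋃ n, G n) (iInf₂_le_of_le (isOpen_iUnion hG)
      (Set.iUnion_mono hEG) ?_)
    refine iSup_le fun F => iSup₂_le fun hFs hF => iSup_le fun μ => iSup₂_le fun hμ1 hμF => ?_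
    rcases eq_or_ne (energy μ) ⊤ with htop | htop
    · simp [htop]
    have hμF' : ∀ᵐ z ∂μ, z ∈ F := hμF
    have hμ : ∀ᵐ z ∂μ, ‖z‖ ≤ 1 := hμF'.mono fun z hz => mem_closedBall_zero_iff.1 (hFs hz).2
    obtain ⟨x, hx0, hx⟩ : ∃ x : ℝ, 0 ≤ x ∧ energy μ = ENNReal.ofReal x :=
      ⟨(energy μ).toReal, ENNReal.toReal_nonneg, (ENNReal.ofReal_toReal htop).symm⟩
    have hGn : ∀ n, μ (G n) ≤ ENNReal.ofReal (ε * √x * (1 / 2) ^ (n + 1)) := by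
      intro n
      rw [(hG n).measure_eq_iSup_isCompact]
      refine iSup_le fun K => iSup₂_le fun hKG hK => ?_
      have h1 := measure_sq_le_of_innerCapacity_le hμ hx0 hx.le (by positivity) (hcap n)
        (hK.inter hF) (fun z hz => ⟨hKG hz.1, (hFs hz.2).2⟩)
      have h2 : μ K = μ (K ∩ F) := (measure_inter_conull hμF).symm
      rw [h2, ← ofReal_measureReal]
      refine ENNReal.ofReal_le_ofReal (abs_le_of_sq_le_sq' ?_ (by positivity)).2
      rw [mul_right_comm, mul_pow _ (√x), Real.sq_sqrt hx0]
      exact h1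
    have hsum : (1 : ℝ≥0∞) ≤ ENNReal.ofReal (ε * √x) := by
      calc (1 : ℝ≥0∞) = μ Set.univ := measure_univ.symm
        _ = μ (Set.univ ∩ F) := (measure_inter_conull hμF).symm
        _ ≤ μ (⋃ n, G n) := measure_mono fun z hz => (hFs hz.2).1
        _ ≤ ∑' n, μ (G n) := measure_iUnion_le _
        _ ≤ ∑' n, ENNReal.ofReal (ε * √x * (1 / 2) ^ (n + 1)) := ENNReal.tsum_le_tsum hGn
        _ = ENNReal.ofReal (ε * √x) := by
          have hs : HasSum (fun n : ℕ => ε * √x * (1 / 2 : ℝ) ^ (n + 1)) (ε * √x) := by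
            have := (hasSum_geometric_two.mul_left (1 / 2 : ℝ)).mul_left (ε * √x)
            simpa [pow_succ', mul_comm] using this
          rw [← ENNReal.ofReal_tsum_of_nonneg (fun n => by positivity) hs.summable, hs.tsum_eq]
    have h1 : 1 ≤ ε * √x := by
      rwa [← ENNReal.ofReal_one, ENNReal.ofReal_le_ofReal_iff (by positivity)] at hsum
    have hxpos : 0 < x := by
      rcases hx0.eq_or_lt with h | h
      · rw [← h, Real.sqrt_zero] at h1
        linarith
      · exact h
    rw [hx, ← ENNReal.ofReal_inv_of_pos hxpos]
    refine ENNReal.ofReal_le_ofReal ?_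
    rw [inv_le_iff_one_le_mul₀ hxpos]
    have h2 : (ε * √x) ^ 2 = ε ^ 2 * x := by rw [mul_pow, Real.sq_sqrt hx0]
    rw [← h2]
    exact one_le_pow₀ h1
  have hlim : Tendsto (fun ε : ℝ => ENNReal.ofReal (ε ^ 2)) (𝓝[>] 0) (𝓝 0) := by
    have : Continuous fun ε : ℝ => ENNReal.ofReal (ε ^ 2) :=
      ENNReal.continuous_ofReal.comp (continuous_pow 2)
    simpa using (this.tendsto 0).mono_left nhdsWithin_le_nhds
  refine le_antisymm (ge_of_tendsto hlim ?_) bot_le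
  filter_upwards [self_mem_nhdsWithin] with ε hε using key ε hε

/-- The form in which the weak type inequality is used: the radial maximal functions of functions of
arbitrarily small norm exceed `t` on `E`. -/
lemma outerCapacity_eq_zero_of_forall_exists {E : Set (CSpace d)} {t : ℝ} (ht : 0 < t)
    (h : ∀ ε > 0, ∃ g : DruryArveson d, ‖g‖ < ε ∧ E ⊆ radialSuperlevelSet g t) :
    outerCapacity E = 0 := by
  have hlim : Tendsto (fun ε : ℝ => ENNReal.ofReal (80 * ε ^ 2 / t ^ 2)) (𝓝[>] 0) (𝓝 0) := by
    have : Continuous fun ε : ℝ => ENNReal.ofReal (80 * ε ^ 2 / t ^ 2) :=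
      ENNReal.continuous_ofReal.comp (by fun_prop)
    simpa using (this.tendsto 0).mono_left nhdsWithin_le_nhds
  refine le_antisymm (ge_of_tendsto hlim ?_) bot_le
  filter_upwards [self_mem_nhdsWithin] with ε hε
  obtain ⟨g, hg, hE⟩ := h ε hε
  refine (outerCapacity_le_of_subset_radialSuperlevelSet ht hE).trans
    (ENNReal.ofReal_le_ofReal ?_)
  gcongr

lemma outerCapacity_union_eq_zero {E E' : Set (CSpace d)} (h : outerCapacity E = 0)
    (h' : outerCapacity E' = 0) : outerCapacity (E ∪ E') = 0 := by
  have h1 := outerCapacity_iUnion_eq_zero (E := fun n : ℕ => if n = 0 then E else E')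
    (fun n => by split_ifs <;> assumption)
  refine le_antisymm ((outerCapacity_mono ?_).trans_eq h1) bot_le
  rintro z (hz | hz)
  · exact Set.mem_iUnion.2 ⟨0, by simpa using hz⟩
  · exact Set.mem_iUnion.2 ⟨1, by simpa using hz⟩

lemma eventually_mem_Ioo_zero_one : ∀ᶠ r : ℝ in 𝓝[<] 1, r ∈ Set.Ioo (0 : ℝ) 1 :=
  Ioo_mem_nhdsLT one_pos

lemma mem_radialSuperlevelSet_of_frequently {f : DruryArveson d} {t : ℝ} {z : CSpace d}
    (h : ∃ᶠ r : ℝ in 𝓝[<] 1, t < ‖inner ℂ (kernelExt (r • z)) f‖) :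
    z ∈ radialSuperlevelSet f t := by
  obtain ⟨r, hr, hr'⟩ := (h.and_eventually eventually_mem_Ioo_zero_one).exists
  exact ⟨r, hr', hr⟩

/-! ### Existence of radial limits -/

lemma HasRadialLimit.add {f g : DruryArveson d} {ζ : CSpace d} {a b : ℂ}
    (hf : HasRadialLimit f ζ a) (hg : HasRadialLimit g ζ b) :
    HasRadialLimit (f + g) ζ (a + b) := by
  rw [hasRadialLimit_iff] at *
  simpa only [inner_add_right] using Tendsto.add hf hg

lemma HasRadialLimit.smul {f : DruryArveson d} {ζ : CSpace d} {a : ℂ}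
    (hf : HasRadialLimit f ζ a) (c : ℂ) : HasRadialLimit (c • f) ζ (c * a) := by
  rw [hasRadialLimit_iff] at *
  simpa only [inner_smul_right] using hf.const_mul c

lemma hasRadialLimit_zero (ζ : CSpace d) : HasRadialLimit (0 : DruryArveson d) ζ 0 := by
  rw [hasRadialLimit_iff]
  simp only [inner_zero_right]
  exact tendsto_const_nhds

lemma hasRadialLimit_kernelFunction (w : UnitBall d) {ζ : CSpace d} (hζ : ‖ζ‖ = 1) :
    HasRadialLimit (kernelFunction w) ζ (daKernel ζ (w : CSpace d)) := by
  have hw : ‖(w : CSpace d)‖ < 1 := mem_ball_zero_iff.1 w.2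
  rw [hasRadialLimit_iff]
  have h1 : Tendsto (fun r : ℝ => r • ζ) (𝓝[<] 1) (𝓝 ζ) := by
    have : Continuous fun r : ℝ => r • ζ := by fun_prop
    simpa using (this.tendsto 1).mono_left nhdsWithin_le_nhds
  have h2 : Tendsto (fun r : ℝ => daKernel (r • ζ) (w : CSpace d)) (𝓝[<] 1)
      (𝓝 (daKernel ζ (w : CSpace d))) := by
    refine Tendsto.div tendsto_const_nhds
      (tendsto_const_nhds.sub (tendsto_const_nhds.inner h1)) ?_
    intro h
    have h3 := norm_inner_le_norm (𝕜 := ℂ) (w : CSpace d) ζ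
    rw [← sub_eq_zero.1 h, hζ, norm_one] at h3
    linarith
  refine h2.congr' ?_
  filter_upwards [eventually_mem_Ioo_zero_one] with r hr
  rw [← kernelExt_coe, inner_kernelExt_kernelExt (smul_mem_ball hr.1.le hr.2 hζ.le) w.2]

/-- Functions with radial limits everywhere on the sphere are dense, since they include the kernel
functions. -/
lemma exists_hasRadialLimit_norm_sub_lt (f : DruryArveson d) {ε : ℝ} (hε : 0 < ε) :
    ∃ g : DruryArveson d, ‖f - g‖ < ε ∧ ∀ ζ : CSpace d, ‖ζ‖ = 1 → ∃ c, HasRadialLimit g ζ c := by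
  let S : Submodule ℂ (DruryArveson d) :=
    { carrier := {g | ∀ ζ : CSpace d, ‖ζ‖ = 1 → ∃ c, HasRadialLimit g ζ c}
      add_mem' := fun ha hb ζ hζ => by
        obtain ⟨a, ha⟩ := ha ζ hζ
        obtain ⟨b, hb⟩ := hb ζ hζ
        exact ⟨_, ha.add hb⟩
      zero_mem' := fun ζ _ => ⟨0, hasRadialLimit_zero ζ⟩
      smul_mem' := fun c a ha ζ hζ => by
        obtain ⟨a, ha⟩ := ha ζ hζ
        exact ⟨_, ha.smul c⟩ }
  have hS : Submodule.span ℂ {RKHS.kerFun (DruryArveson d) x v | (x) (v)} ≤ S := by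
    rw [Submodule.span_le]
    rintro _ ⟨w, v, rfl⟩
    have h1 : RKHS.kerFun (DruryArveson d) w v = v • kernelFunction w := by
      rw [kernelFunction, ← map_smul, smul_eq_mul, mul_one]
    rw [h1]
    exact S.smul_mem v fun ζ hζ => ⟨_, hasRadialLimit_kernelFunction w hζ⟩
  have hf : f ∈ closure (S : Set (DruryArveson d)) := by
    have h2 : f ∈ (Submodule.span ℂ
        {RKHS.kerFun (DruryArveson d) x v | (x) (v)}).topologicalClosure := by
      rw [RKHS.kerFun_dense]
      trivial
    exact closure_mono hS h2
  obtain ⟨g, hg, hfg⟩ := Metric.mem_closure_iff.1 hf ε hε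
  exact ⟨g, by rwa [← dist_eq_norm], hg⟩

lemma outerCapacity_not_exists_hasRadialLimit (f : DruryArveson d) :
    outerCapacity {ζ | ζ ∈ Metric.sphere (0 : CSpace d) 1 ∧ ¬ ∃ c, HasRadialLimit f ζ c} = 0 := by
  -- `E n` is the set where the oscillation of `f` along the radius is at least `3 / (n + 1)`
  set E : ℕ → Set (CSpace d) := fun n => {ζ | ζ ∈ Metric.sphere (0 : CSpace d) 1 ∧
    ∀ δ > 0, ∃ r ∈ Set.Ioo (1 - δ) (1 : ℝ), ∃ s ∈ Set.Ioo (1 - δ) (1 : ℝ),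
      3 / ((n : ℝ) + 1) ≤ ‖inner ℂ (kernelExt (r • ζ)) f - inner ℂ (kernelExt (s • ζ)) f‖} with hE
  have hnull : ∀ n, outerCapacity (E n) = 0 := by
    intro n
    have hn : (0 : ℝ) < 1 / ((n : ℝ) + 1) := by positivity
    refine outerCapacity_eq_zero_of_forall_exists hn fun ε hε => ?_
    obtain ⟨g, hg, hlim⟩ := exists_hasRadialLimit_norm_sub_lt f hε
    refine ⟨f - g, hg, fun ζ hζ => ?_⟩
    obtain ⟨c, hc⟩ := hlim ζ (mem_sphere_zero_iff_norm.1 hζ.1)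
    rw [hasRadialLimit_iff] at hc
    by_contra hcon
    have hsmall : ∀ r ∈ Set.Ioo (0 : ℝ) 1,
        ‖inner ℂ (kernelExt (r • ζ)) f - inner ℂ (kernelExt (r • ζ)) g‖ ≤ 1 / ((n : ℝ) + 1) := by
      intro r hr
      rw [← inner_sub_right]
      exact not_lt.1 fun h => hcon ⟨r, hr, h⟩
    have hev : ∀ᶠ r : ℝ in 𝓝[<] 1,
        ‖inner ℂ (kernelExt (r • ζ)) g - c‖ < 1 / ((n : ℝ) + 1) / 2 := by
      have := (Metric.tendsto_nhds.1 hc) _ (half_pos hn)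
      simpa only [dist_eq_norm] using this
    obtain ⟨a, ha, hsub⟩ :=
      (mem_nhdsLT_iff_exists_Ioo_subset' zero_lt_one).1 (hev.and eventually_mem_Ioo_zero_one)
    obtain ⟨r, hr, s, hs, hle⟩ := hζ.2 (1 - a) (sub_pos.2 ha)
    rw [sub_sub_cancel] at hr hs
    obtain ⟨hr1, hr2⟩ := hsub hr
    obtain ⟨hs1, hs2⟩ := hsub hs
    have htri : ‖inner ℂ (kernelExt (r • ζ)) f - inner ℂ (kernelExt (s • ζ)) f‖ ≤
        ‖inner ℂ (kernelExt (r • ζ)) f - inner ℂ (kernelExt (r • ζ)) g‖ +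
        ‖inner ℂ (kernelExt (r • ζ)) g - c‖ + (‖inner ℂ (kernelExt (s • ζ)) g - c‖ +
        ‖inner ℂ (kernelExt (s • ζ)) f - inner ℂ (kernelExt (s • ζ)) g‖) := by
      have e : inner ℂ (kernelExt (r • ζ)) f - inner ℂ (kernelExt (s • ζ)) f =
          (inner ℂ (kernelExt (r • ζ)) f - inner ℂ (kernelExt (r • ζ)) g) +
          (inner ℂ (kernelExt (r • ζ)) g - c) - ((inner ℂ (kernelExt (s • ζ)) g - c) +
          (inner ℂ (kernelExt (s • ζ)) f - inner ℂ (kernelExt (s • ζ)) g)) := by ring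
      rw [e]
      exact (norm_sub_le _ _).trans (add_le_add (norm_add_le _ _) (norm_add_le _ _))
    have e3 : 3 / ((n : ℝ) + 1) = 3 * (1 / ((n : ℝ) + 1)) := by ring
    rw [e3] at hle
    linarith [hsmall r hr2, hsmall s hs2]
  refine le_antisymm ((outerCapacity_mono ?_).trans_eq (outerCapacity_iUnion_eq_zero hnull)) bot_le
  rintro ζ ⟨hζ, hno⟩
  by_contra hcon
  apply hno
  simp only [hasRadialLimit_iff]
  refine cauchy_map_iff_exists_tendsto.1 (Metric.cauchy_iff.2 ⟨inferInstance, fun ε hε => ?_⟩)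
  obtain ⟨n, hn⟩ := exists_nat_one_div_lt (show 0 < ε / 3 by positivity)
  have hn' : ζ ∉ E n := fun h => hcon (Set.mem_iUnion.2 ⟨n, h⟩)
  have : ∃ δ > 0, ∀ r ∈ Set.Ioo (1 - δ) (1 : ℝ), ∀ s ∈ Set.Ioo (1 - δ) (1 : ℝ),
      ‖inner ℂ (kernelExt (r • ζ)) f - inner ℂ (kernelExt (s • ζ)) f‖ < 3 / ((n : ℝ) + 1) := by
    by_contra! h
    exact hn' ⟨hζ, h⟩
  obtain ⟨δ, hδ, h⟩ := this
  refine ⟨_, image_mem_map (Ioo_mem_nhdsLT (show 1 - δ < 1 by linarith)), ?_⟩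
  rintro _ ⟨r, hr, rfl⟩ _ ⟨s, hs, rfl⟩
  rw [dist_eq_norm]
  refine (h r hr s hs).trans ?_
  have e3 : 3 / ((n : ℝ) + 1) = 3 * (1 / ((n : ℝ) + 1)) := by ring
  rw [e3]
  linarith

/-! ### Products -/

lemma norm_inner_kernelExt_le_of_eq_mul {f g : DruryArveson d} {φ : UnitBall d → ℂ} {C : ℝ}
    (hφ : ∀ z, ‖φ z‖ ≤ C) (hg : ∀ z, g z = φ z * f z) (x : CSpace d) :
    ‖inner ℂ (kernelExt x) g‖ ≤ C * ‖inner ℂ (kernelExt x) f‖ := by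
  by_cases hx : x ∈ Metric.ball (0 : CSpace d) 1
  · lift x to UnitBall d using hx
    rw [kernelExt_coe, inner_kernelFunction, inner_kernelFunction, hg, norm_mul]
    exact mul_le_mul_of_nonneg_right (hφ x) (norm_nonneg _)
  · simp [kernelExt_of_notMem hx]

lemma boundaryZeroSet_subset_of_eq_mul {f g : DruryArveson d} {φ : UnitBall d → ℂ} {C : ℝ}
    (hφ : ∀ z, ‖φ z‖ ≤ C) (hg : ∀ z, g z = φ z * f z) :
    boundaryZeroSet f ⊆ boundaryZeroSet g := by
  rintro ζ ⟨hζ, hf⟩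
  refine ⟨hζ, ?_⟩
  rw [hasRadialLimit_iff] at hf ⊢
  refine squeeze_zero_norm (fun r => norm_inner_kernelExt_le_of_eq_mul hφ hg _) ?_
  simpa using hf.norm.const_mul C

lemma exists_norm_eval_le (p : MvPolynomial (Fin d) ℂ) :
    ∃ C : ℝ, ∀ z : UnitBall d, ‖MvPolynomial.eval (fun i => (z : CSpace d) i) p‖ ≤ C := by
  have hc : Continuous fun z : CSpace d => MvPolynomial.eval (fun i => z i) p :=
    (MvPolynomial.continuous_eval p).comp (by fun_prop)
  obtain ⟨C, hC⟩ := (isCompact_closedBall (0 : CSpace d) 1).exists_bound_of_continuousOn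
    hc.continuousOn
  exact ⟨C, fun z => hC z (Metric.ball_subset_closedBall z.2)⟩

/-- By the closed graph theorem, multiplication by a multiplier is a bounded operator `T`; then
`φ z * K(z, z) = ⟨K_z, T K_z⟩` bounds `φ`. -/
lemma IsMultiplier.exists_norm_le {φ : UnitBall d → ℂ} (hφ : IsMultiplier φ) :
    ∃ C : ℝ, ∀ z, ‖φ z‖ ≤ C := by
  choose T hT using hφ
  let L : DruryArveson d →ₗ[ℂ] DruryArveson d :=
    { toFun := T
      map_add' := fun f g => by
        ext z
        rw [RKHS.coe_add, Pi.add_apply, hT, hT, hT, RKHS.coe_add, Pi.add_apply, mul_add]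
      map_smul' := fun c f => by
        ext z
        rw [RKHS.coe_smul, Pi.smul_apply, hT, hT, RKHS.coe_smul, Pi.smul_apply, RingHom.id_apply,
          smul_eq_mul, smul_eq_mul, mul_left_comm] }
  have hL : Continuous L := by
    refine L.continuous_of_seq_closed_graph fun u x y hu hTu => ?_
    ext z
    have h1 : Tendsto (fun n => T (u n) z) atTop (𝓝 (y z)) :=
      ((RKHS.continuous_eval z).tendsto y).comp hTu
    have h2 : Tendsto (fun n => φ z * u n z) atTop (𝓝 (φ z * x z)) :=
      (((RKHS.continuous_eval z).tendsto x).comp hu).const_mul _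
    simp only [hT] at h1
    exact (tendsto_nhds_unique h1 h2).trans (hT x z).symm
  let B : DruryArveson d →L[ℂ] DruryArveson d := ⟨L, hL⟩
  refine ⟨‖B‖, fun z => ?_⟩
  have hz : ‖(z : CSpace d)‖ < 1 := mem_ball_zero_iff.1 z.2
  have hpos : 0 < ‖kernelFunction z‖ ^ 2 := by
    rw [norm_sq_kernelFunction, one_div_pos]
    nlinarith [norm_nonneg (z : CSpace d)]
  have h1 : inner ℂ (kernelFunction z) (B (kernelFunction z)) =
      φ z * inner ℂ (kernelFunction z) (kernelFunction z) := by
    rw [inner_kernelFunction, inner_kernelFunction]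
    exact hT _ z
  have h2 : ‖φ z‖ * ‖kernelFunction z‖ ^ 2 ≤ ‖B‖ * ‖kernelFunction z‖ ^ 2 := by
    calc ‖φ z‖ * ‖kernelFunction z‖ ^ 2 = ‖inner ℂ (kernelFunction z) (B (kernelFunction z))‖ := by
          rw [h1, norm_mul, inner_self_eq_norm_sq_to_K]
          simp
      _ ≤ ‖kernelFunction z‖ * ‖B (kernelFunction z)‖ := norm_inner_le_norm _ _
      _ ≤ ‖kernelFunction z‖ * (‖B‖ * ‖kernelFunction z‖) := by
          gcongr
          exact B.le_opNorm _
      _ = ‖B‖ * ‖kernelFunction z‖ ^ 2 := by ring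
  exact le_of_mul_le_mul_right h2 hpos

/-! ### Cyclic functions -/

lemma IsCyclicFunction.outerCapacity_boundaryZeroSet {f : DruryArveson d}
    (hf : IsCyclicFunction f) : outerCapacity (boundaryZeroSet f) = 0 := by
  obtain ⟨p, g, u, hg, hu, hlim⟩ := hf
  refine outerCapacity_eq_zero_of_forall_exists (t := 1 / 2) (by norm_num) fun ε hε => ?_
  obtain ⟨n, hn⟩ := ((Metric.tendsto_nhds.1 hlim) ε hε).exists
  refine ⟨u - g n, by rwa [dist_comm, dist_eq_norm] at hn, fun ζ hζ => ?_⟩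
  obtain ⟨C, hC⟩ := exists_norm_eval_le (p n)
  obtain ⟨hζ1, hgζ⟩ := boundaryZeroSet_subset_of_eq_mul hC (hg n) hζ
  rw [hasRadialLimit_iff] at hgζ
  refine mem_radialSuperlevelSet_of_frequently (Eventually.frequently ?_)
  have h1 : ∀ᶠ r : ℝ in 𝓝[<] 1, inner ℂ (kernelExt (r • ζ)) u = 1 := by
    filter_upwards [eventually_mem_Ioo_zero_one] with r hr
    rw [← hu ⟨r • ζ, smul_mem_ball hr.1.le hr.2 (mem_sphere_zero_iff_norm.1 hζ1).le⟩,
      ← inner_kernelFunction, ← kernelExt_coe]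
  have h2 : Tendsto (fun r : ℝ => ‖inner ℂ (kernelExt (r • ζ)) (u - g n)‖) (𝓝[<] 1)
      (𝓝 ‖(1 : ℂ) - 0‖) := by
    simp only [inner_sub_right]
    exact ((tendsto_const_nhds.congr' (h1.mono fun r hr => hr.symm)).sub hgζ).norm
  exact h2.eventually_const_lt (by norm_num)

/-! ### The subspace of functions vanishing quasi-everywhere -/

/-- The functions in `H^2_d` whose boundary values vanish quasi-everywhere on `E`. -/
def vanishingSubmodule {E : Set (CSpace d)} (hE : E ⊆ Metric.sphere 0 1) : Submodule ℂ (DruryArveson d) where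
  carrier := {f | VanishesQuasiEverywhereOn f E}
  zero_mem' := by
    refine outerCapacity_eq_zero_of_forall_exists one_pos fun ε hε => ⟨0, by simpa using hε, ?_⟩
    exact fun ζ hζ => absurd ⟨hE hζ.1, hasRadialLimit_zero ζ⟩ hζ.2
  add_mem' {f g} hf hg := by
    refine le_antisymm ((outerCapacity_mono ?_).trans_eq (outerCapacity_union_eq_zero hf hg))
      bot_le
    rintro ζ ⟨hζ, hno⟩
    by_contra hcon
    simp only [Set.mem_union, Set.mem_sdiff, hζ, true_and, not_or, not_not] at hcon
    exact hno ⟨hcon.1.1, by simpa using hcon.1.2.add hcon.2.2⟩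
  smul_mem' c f hf := by
    refine le_antisymm ((outerCapacity_mono (Set.sdiff_subset_sdiff_right ?_)).trans_eq hf) bot_le
    exact fun ζ hζ => ⟨hζ.1, by simpa using hζ.2.smul c⟩

lemma isClosed_vanishes {E : Set (CSpace d)} (hE : E ⊆ Metric.sphere 0 1) :
    IsClosed {f : DruryArveson d | VanishesQuasiEverywhereOn f E} := by
  refine IsSeqClosed.isClosed fun u f hu hlim => ?_
  -- if all `u n` have boundary value zero at `ζ` and `f` has not, then `ζ` lies in some `A m`
  set A : ℕ → Set (CSpace d) := fun m => {ζ | (∀ n, ζ ∈ boundaryZeroSet (u n)) ∧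
    ∃ᶠ r : ℝ in 𝓝[<] 1, 1 / ((m : ℝ) + 1) < ‖inner ℂ (kernelExt (r • ζ)) f‖} with hA
  have hnull : ∀ m, outerCapacity (A m) = 0 := by
    intro m
    have hm : (0 : ℝ) < 1 / ((m : ℝ) + 1) := by positivity
    refine outerCapacity_eq_zero_of_forall_exists (half_pos hm) fun ε hε => ?_
    obtain ⟨n, hn⟩ := ((Metric.tendsto_nhds.1 hlim) ε hε).exists
    refine ⟨f - u n, by rwa [dist_comm, dist_eq_norm] at hn, fun ζ hζ => ?_⟩
    have h0 := (hasRadialLimit_iff.1 (hζ.1 n).2).norm.eventually_lt_const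
      (by rw [norm_zero]; exact half_pos hm)
    refine mem_radialSuperlevelSet_of_frequently ((hζ.2.and_eventually h0).mono ?_)
    rintro r ⟨h1, h2⟩
    rw [inner_sub_right]
    have := norm_sub_norm_le (inner ℂ (kernelExt (r • ζ)) f) (inner ℂ (kernelExt (r • ζ)) (u n))
    linarith
  have h := outerCapacity_union_eq_zero (outerCapacity_iUnion_eq_zero hu)
    (outerCapacity_iUnion_eq_zero hnull)
  refine le_antisymm ((outerCapacity_mono ?_).trans_eq h) bot_le
  rintro ζ ⟨hζ, hno⟩
  by_contra hcon
  simp only [Set.mem_union, Set.mem_iUnion, Set.mem_sdiff, hζ, true_and, not_or, not_exists,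
    not_not] at hcon
  refine hno ⟨hE hζ, hasRadialLimit_iff.2 (Metric.tendsto_nhds.2 fun ε hε => ?_)⟩
  obtain ⟨m, hm⟩ := exists_nat_one_div_lt hε
  have h1 : ¬ ∃ᶠ r : ℝ in 𝓝[<] 1, 1 / ((m : ℝ) + 1) < ‖inner ℂ (kernelExt (r • ζ)) f‖ :=
    fun h => hcon.2 m ⟨hcon.1, h⟩
  filter_upwards [not_frequently.1 h1] with r hr
  rw [dist_zero_right]
  exact (not_lt.1 hr).trans_lt hm

end

theorem theorem1p5 (d : ℕ) :
    -- the boundary function exists outside a set of outer capacity zero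
    (∀ f : DruryArveson d,
      outerCapacity {ζ | ζ ∈ Metric.sphere (0 : CSpace d) 1 ∧ ¬ ∃ c, HasRadialLimit f ζ c} = 0) ∧
    -- the zero set of the boundary function of a cyclic function has outer capacity zero
    (∀ f : DruryArveson d, IsCyclicFunction f → outerCapacity (boundaryZeroSet f) = 0) ∧
    -- vanishing quasi-everywhere on `E` defines a closed multiplier invariant subspace
    (∀ E : Set (CSpace d), E ⊆ Metric.sphere 0 1 →
      ∃ M : Submodule ℂ (DruryArveson d),
        (∀ f : DruryArveson d, f ∈ M ↔ VanishesQuasiEverywhereOn f E) ∧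
        IsClosed (M : Set (DruryArveson d)) ∧
        ∀ φ : UnitBall d → ℂ, IsMultiplier φ → ∀ f ∈ M, ∀ g : DruryArveson d,
          (∀ z : UnitBall d, g z = φ z * f z) → g ∈ M) := by
  refine ⟨outerCapacity_not_exists_hasRadialLimit,
    fun f hf => hf.outerCapacity_boundaryZeroSet, fun E hE =>
    ⟨vanishingSubmodule hE, fun f => Iff.rfl, isClosed_vanishes hE, fun φ hφ f hf g hg => ?_⟩⟩
  obtain ⟨C, hC⟩ := hφ.exists_norm_le
  exact le_antisymm ((outerCapacity_mono (Set.sdiff_subset_sdiff_right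
    (boundaryZeroSet_subset_of_eq_mul hC hg))).trans_eq hf) bot_le
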